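/- Let $(W,S)$ be a finite Coxeter system (with $S$ finite), let $T=\{wsw^{-1}:s\in S,\ w\in W\}$ be its set of reflections, let $\ell_T$ be word length with respect to $T$, and let $\pi\le_T\mu$ mean $\ell_T(\mu)=\ell_T(\pi)+\ell_T(\pi^{-1}\mu)$. A Coxeter element of $(W,S)$ is any conjugate of a product of all the elements of $S$, each taken once, in some order. Fix a Coxeter element $c$ of $W$, let $NC(W)=\{w\in W:1\le_T w\le_T c\}$, and let $k\in\{1,2,3,\dots\}\cup\{\infty\}$. Let $NC^{(k)}(W)$ be the set of $k$-multichains $(\pi)_k=(\pi_1,\pi_2,\dots,\pi_k)$, $\pi_1\le_T\pi_2\le_T\cdots\le_T\pi_k$, in $NC(W)$; if $k=\infty$, these are infinite sequences $\pi_1\le_T\pi_2\le_T\cdots$ in $NC(W)$ with $\pi_r=c$ for all large $r$. If $k<\infty$ put $\pi_{k+1}=c$. Let $NC_{(k)}(W)$ be the set of $k$-delta sequences $(\delta)_k=(\delta_1,\delta_2,\dots,\delta_k)$, that is, sequences in $NC(W)$, with only finitely many entries different from $1$ if $k=\infty$, for which there is a (necessarily unique) $\delta_0\in NC(W)$ with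 $c=\delta_0\delta_1\delta_2\cdots$ and $\ell_T(c)=\sum_{i\ge 0}\ell_T(\delta_i)$. Let $\partial(\pi)_k$ be the delta sequence with $\delta_0=\pi_1$ and $\delta_i=\pi_i^{-1}\pi_{i+1}$ for $1\le i\le k$ (for all $i\geq 1$ if $k=\infty$). Order $NC_{(k)}(W)$ componentwise by $\le_T$, and order $NC^{(k)}(W)$ by $(\pi)_k\le(\mu)_k$ if and only if $\partial(\mu)_k\le\partial(\pi)_k$. A parabolic subgroup of $W$ is a subgroup $W'=w\langle I\rangle w^{-1}$ with $w\in W$ and $I\subseteq S$; it is considered with the simple generators $wIw^{-1}$. When $\pi_1$ is a Coxeter element of $W'$, let $NC^{(k)}(W')$ and $NC_{(k)}(W')$ be the posets defined as above for $(W',wIw^{-1})$ and the Coxeter element $\pi_1$. **Theorem.** Let $(\pi)_k\in NC^{(k)}(W)$ and $(\delta)_k=\partial(\pi)_k$. There is a unique parabolic subgroup $W'$ of $W$ in which $\pi_1=\delta_0$ is a Coxeter element. Moreover, for every presentation $W'=w\langle I\rangle w^{-1}$ such that $\pi_1$ is a Coxeter element of $(W',wIw^{-1})$: 1. The principal order ideal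 $\{(\mu)_k\in NC^{(k)}(W):(\mu)_k\le(\pi)_k\}$ is isomorphic, as a poset, to $NC^{(k)}(W')$ via the map $$(\mu_1,\mu_2,\dots,\mu_k)\mapsto(\mu_1,\ \mu_2\pi_2^{-1}\pi_1,\ \mu_3\pi_3^{-1}\pi_1,\dots,\ \mu_k\pi_k^{-1}\pi_1).$$ 2. The principal order filter $\{(\varepsilon)_k\in NC_{(k)}(W):(\delta)_k\le(\varepsilon)_k\}$ is isomorphic, as a poset, to $NC_{(k)}(W')$ via the map whose $i$-th entry is $$\pi_1^{-1}\pi_i\,\varepsilon_i\,\pi_{i+1}^{-1}\pi_1 ;$$ for $k<\infty$ this is the map $$(\varepsilon_1,\dots,\varepsilon_k)\mapsto(\varepsilon_1\pi_2^{-1}\pi_1,\ \pi_1^{-1}\pi_2\varepsilon_2\pi_3^{-1}\pi_1,\dots,\ \pi_1^{-1}\pi_{k-1}\varepsilon_{k-1}\pi_k^{-1}\pi_1,\ \pi_1^{-1}\pi_k\varepsilon_kc^{-1}\pi_1).$$ For $k=\infty$ the maps are given by the same formulas for all $i\ge 1$. -/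

import Mathlib

namespace KDivNC

/-! ### Absolute length, absolute order, Coxeter elements and noncrossing partitions

The notions of this section make sense for a group `G` with a set `S` of generators. They are used
for a finite Coxeter group with its simple generators, and for a parabolic subgroup with the
simple generators that it inherits. -/

section Absolute

variable {G : Type*} [Group G]

/-- The set `T` of reflections: all conjugates of the simple generators. -/
def reflections (S : Set G) : Set G :=
  {t | ∃ s ∈ S, ∃ g : G, t = g * s * g⁻¹}

/-- The absolute length `ℓ_T`: word length with respect to all reflections. -/
noncomputable def absLength (S : Set G) (g : G) : ℕ :=
  sInf {n | ∃ l : List G, (∀ t ∈ l, t ∈ reflections S) ∧ l.prod = g ∧ l.length = n}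

/-- The absolute order `π ≤_T μ`. -/
def AbsLE (S : Set G) (x y : G) : Prop :=
  absLength S y = absLength S x + absLength S (x⁻¹ * y)

/-- A standard Coxeter element: the product of all simple generators, each taken once, in some
order. -/
def IsStandardCoxeterElement (S : Set G) (c : G) : Prop :=
  ∃ l : List G, l.Nodup ∧ (∀ s, s ∈ l ↔ s ∈ S) ∧ l.prod = c

/-- A Coxeter element: any conjugate of a standard Coxeter element. -/
def IsCoxeterElement (S : Set G) (c : G) : Prop :=
  ∃ c₀ : G, IsStandardCoxeterElement S c₀ ∧ IsConj c₀ c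

/-- The noncrossing partitions: the interval `[1, c]` in the absolute order. -/
def NC (S : Set G) (c : G) : Set G :=
  {x | AbsLE S 1 x ∧ AbsLE S x c}

/-! ### Facts about the absolute length -/

theorem exists_word {S : Set G} (hS : Submonoid.closure S = ⊤) (g : G) :
    ∃ l : List G, (∀ t ∈ l, t ∈ reflections S) ∧ l.prod = g := by
  have hg : g ∈ Submonoid.closure S := by rw [hS]; trivial
  obtain ⟨l, hl, rfl⟩ := Submonoid.exists_list_of_mem_closure hg
  exact ⟨l, fun t ht => ⟨t, hl t ht, 1, by simp⟩, rfl⟩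

theorem exists_min_word {S : Set G} (hS : Submonoid.closure S = ⊤) (g : G) :
    ∃ l : List G, (∀ t ∈ l, t ∈ reflections S) ∧ l.prod = g ∧ l.length = absLength S g := by
  obtain ⟨l, h1, h2⟩ := exists_word hS g
  exact Nat.sInf_mem
    (s := {n | ∃ l : List G, (∀ t ∈ l, t ∈ reflections S) ∧ l.prod = g ∧ l.length = n})
    ⟨l.length, l, h1, h2, rfl⟩

theorem absLength_le {S : Set G} {l : List G} (hl : ∀ t ∈ l, t ∈ reflections S) :
    absLength S l.prod ≤ l.length :=
  Nat.sInf_le ⟨l, hl, rfl, rfl⟩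

theorem absLength_one (S : Set G) : absLength S (1 : G) = 0 := by
  have h := absLength_le (S := S) (l := []) (by simp)
  simpa using h

theorem absLength_mul_le {S : Set G} (hS : Submonoid.closure S = ⊤) (a b : G) :
    absLength S (a * b) ≤ absLength S a + absLength S b := by
  obtain ⟨l, h1, h2, h3⟩ := exists_min_word hS a
  obtain ⟨m, k1, k2, k3⟩ := exists_min_word hS b
  have h := absLength_le (S := S) (l := l ++ m) (by
    intro t ht
    rcases List.mem_append.1 ht with h | h
    · exact h1 t h
    · exact k1 t h)
  simpa [h2, h3, k2, k3] using h

theorem absLength_conj_le {S : Set G} (hS : Submonoid.closure S = ⊤) (g a : G) :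
    absLength S (g * a * g⁻¹) ≤ absLength S a := by
  obtain ⟨l, h1, h2, h3⟩ := exists_min_word hS a
  have h := absLength_le (S := S) (l := l.map (MulAut.conj g)) (by
    intro t ht
    obtain ⟨u, hu, rfl⟩ := List.mem_map.1 ht
    obtain ⟨s, hs, x, rfl⟩ := h1 u hu
    exact ⟨s, hs, g * x, by simp [mul_assoc]⟩)
  rw [← map_list_prod, h2] at h
  simpa [h3] using h

theorem absLE_one (S : Set G) (x : G) : AbsLE S 1 x := by
  simp [AbsLE, absLength_one]

theorem absLE_refl (S : Set G) (x : G) : AbsLE S x x := by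
  simp [AbsLE, absLength_one]

/-- If `x ≤_T y ≤_T c` then `x⁻¹ y` lies in `[1, c]`. -/
theorem inv_mul_mem_NC {S : Set G} (hS : Submonoid.closure S = ⊤) {x y c : G}
    (hxy : AbsLE S x y) (hyc : AbsLE S y c) : x⁻¹ * y ∈ NC S c := by
  refine ⟨absLE_one S _, le_antisymm ?_ ?_⟩
  · have h := absLength_mul_le hS (x⁻¹ * y) ((x⁻¹ * y)⁻¹ * c)
    rwa [mul_inv_cancel_left] at h
  · have h := absLength_mul_le hS ((x⁻¹ * y)⁻¹ * x * ((x⁻¹ * y)⁻¹)⁻¹) (y⁻¹ * c)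
    have h' := absLength_conj_le hS (x⁻¹ * y)⁻¹ x
    have e : (x⁻¹ * y)⁻¹ * x * ((x⁻¹ * y)⁻¹)⁻¹ * (y⁻¹ * c) = (x⁻¹ * y)⁻¹ * c := by group
    rw [e] at h
    unfold AbsLE at hxy hyc
    omega

end Absolute

/-! ### Sequences of length `k`, where `k` is finite or infinite -/

/-- The index set of sequences of length `k ∈ ℕ ∪ {∞}`. Indices start at `0`: the index `i` stands
for the `(i+1)`-st entry of a sequence `(x₁, x₂, …)`. -/
abbrev Idx (k : ℕ∞) : Type := {i : ℕ // (i : ℕ∞) < k}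

/-- The index of the first entry. -/
def Idx.first {k : ℕ∞} (hk : 1 ≤ k) : Idx k :=
  ⟨0, lt_of_lt_of_le (by simp) hk⟩

open Classical in
/-- The sequence `x` of length `k`, continued by the constant `a` after its last entry. -/
noncomputable def extend {G : Type*} {k : ℕ∞} (a : G) (x : Idx k → G) (i : ℕ) : G :=
  if h : (i : ℕ∞) < k then x ⟨i, h⟩ else a

/-! ### Multichains, delta sequences and the two posets -/

section Posets

variable {G : Type*} [Group G]

/-- The set `NC^{(k)}` of `k`-multichains `π₁ ≤_T π₂ ≤_T ⋯` in `[1, c]`. The last condition is empty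
for finite `k`; for `k = ∞` it says that the multichain is eventually equal to `c`. -/
@[ext]
structure Multichain (k : ℕ∞) (S : Set G) (c : G) where
  /-- the entries -/
  entry : Idx k → G
  mem_NC : ∀ i, entry i ∈ NC S c
  mono : ∀ i j : Idx k, i ≤ j → AbsLE S (entry i) (entry j)
  eventually : ∃ N : ℕ, ∀ r, N ≤ r → extend c entry r = c

/-- `[δ₀; δ₁, δ₂, …]` is a `k`-delta sequence for `c`: all entries lie in `[1, c]`, only finitely
many differ from `1`, their ordered product is `c`, and their absolute lengths add up to that
of `c`. For finite `k` the finiteness is automatic. -/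
def IsDelta {k : ℕ∞} (S : Set G) (c : G) (δ₀ : G) (δ : Idx k → G) : Prop :=
  δ₀ ∈ NC S c ∧ (∀ i, δ i ∈ NC S c) ∧
    ∃ N : ℕ, (∀ r, N ≤ r → extend 1 δ r = 1) ∧
      c = δ₀ * ((List.range N).map (extend 1 δ)).prod ∧
      absLength S c = absLength S δ₀ + ∑ i ∈ Finset.range N, absLength S (extend 1 δ i)

/-- The set `NC_{(k)}` of `k`-delta sequences `(δ₁, δ₂, …)`; the entry `δ₀` is determined by the
others and left implicit. -/
@[ext]
structure DeltaSeq (k : ℕ∞) (S : Set G) (c : G) where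
  /-- the entries `δ₁, δ₂, …` -/
  entry : Idx k → G
  isDelta : ∃ δ₀ : G, IsDelta S c δ₀ entry

/-- The componentwise order on `NC_{(k)}`. -/
instance (k : ℕ∞) (S : Set G) (c : G) : LE (DeltaSeq k S c) :=
  ⟨fun δ ε => ∀ i, AbsLE S (δ.entry i) (ε.entry i)⟩

/-- The entries `δ_i = π_i⁻¹ π_{i+1}` of `∂π`, where `π_{k+1} = c`. -/
noncomputable def Multichain.diff {k : ℕ∞} {S : Set G} {c : G} (π : Multichain k S c)
    (i : Idx k) : G :=
  (π.entry i)⁻¹ * extend c π.entry (i.1 + 1)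

/-- The order on `NC^{(k)}`: `π ≤ μ` when `∂μ ≤ ∂π` componentwise. -/
instance (k : ℕ∞) (S : Set G) (c : G) : LE (Multichain k S c) :=
  ⟨fun π μ => ∀ i, AbsLE S (μ.diff i) (π.diff i)⟩

theorem extend_entry_absLE {k : ℕ∞} {S : Set G} {c : G} (π : Multichain k S c) (i : ℕ) :
    AbsLE S (extend c π.entry i) c := by
  unfold extend
  split_ifs with h
  · exact (π.mem_NC _).2
  · exact absLE_refl S c

theorem extend_entry_succ {k : ℕ∞} {S : Set G} {c : G} (π : Multichain k S c) (i : ℕ) :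
    AbsLE S (extend c π.entry i) (extend c π.entry (i + 1)) := by
  by_cases h : ((i + 1 : ℕ) : ℕ∞) < k
  · have h' : (i : ℕ∞) < k := lt_of_le_of_lt (by exact_mod_cast Nat.le_succ i) h
    simp only [extend, dif_pos h, dif_pos h']
    exact π.mono _ _ (Nat.le_succ i)
  · have e : extend c π.entry (i + 1) = c := by simp only [extend, dif_neg h]
    rw [e]
    exact extend_entry_absLE π i

theorem extend_diff {k : ℕ∞} {S : Set G} {c : G} (π : Multichain k S c) (i : ℕ) :
    extend 1 π.diff i = (extend c π.entry i)⁻¹ * extend c π.entry (i + 1) := by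
  by_cases h : (i : ℕ∞) < k
  · simp only [extend, dif_pos h, Multichain.diff]
  · have h' : ¬ ((i + 1 : ℕ) : ℕ∞) < k := fun h2 =>
      h (lt_of_le_of_lt (by exact_mod_cast Nat.le_succ i) h2)
    simp only [extend, dif_neg h, dif_neg h', inv_mul_cancel]

theorem diff_prod {k : ℕ∞} {S : Set G} {c : G} (π : Multichain k S c) (n : ℕ) :
    extend c π.entry 0 * ((List.range n).map (extend 1 π.diff)).prod = extend c π.entry n := by
  induction n with
  | zero => simp
  | succ n ih =>
    rw [List.range_succ, List.map_append, List.prod_append, ← mul_assoc, ih]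
    simp [extend_diff]

theorem diff_sum {k : ℕ∞} {S : Set G} {c : G} (π : Multichain k S c) (n : ℕ) :
    absLength S (extend c π.entry n) = absLength S (extend c π.entry 0) +
      ∑ i ∈ Finset.range n, absLength S (extend 1 π.diff i) := by
  induction n with
  | zero => simp
  | succ n ih =>
    rw [Finset.sum_range_succ, ← add_assoc, ← ih, extend_diff]
    exact extend_entry_succ π n

/-- The map `∂ : NC^{(k)} → NC_{(k)}`,
`∂(π₁, …, π_k) = [π₁; π₁⁻¹ π₂, …, π_{k-1}⁻¹ π_k, π_k⁻¹ c]`. -/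
noncomputable def Multichain.delta {k : ℕ∞} {S : Set G} {c : G} (hS : Submonoid.closure S = ⊤)
    (π : Multichain k S c) : DeltaSeq k S c where
  entry := π.diff
  isDelta := by
    refine ⟨extend c π.entry 0, ⟨absLE_one S _, extend_entry_absLE π 0⟩, ?_, ?_⟩
    · intro i
      have e := extend_diff π i.1
      have e' : extend 1 π.diff i.1 = π.diff i := by simp only [extend, dif_pos i.2]
      rw [← e', e]
      exact inv_mul_mem_NC hS (extend_entry_succ π _) (extend_entry_absLE π _)
    · obtain ⟨N, hN⟩ := π.eventually
      refine ⟨N, ?_, ?_, ?_⟩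
      · intro r hr
        rw [extend_diff, hN r hr, hN (r + 1) (by omega), inv_mul_cancel]
      · rw [diff_prod, hN N le_rfl]
      · rw [← diff_sum, hN N le_rfl]

end Posets

/-! ### Parabolic subgroups -/

section Parabolic

variable {B : Type*} {M : CoxeterMatrix B} {W : Type*} [Group W]

/-- The set of simple generators of a Coxeter system. -/
def simples (cs : CoxeterSystem M W) : Set W := Set.range cs.simple

/-- The parabolic subgroup `w W_I w⁻¹`, where `W_I` is generated by the `s_i` with `i ∈ I`. -/
def parabolic (cs : CoxeterSystem M W) (w : W) (I : Set B) : Subgroup W :=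
  (Subgroup.closure (cs.simple '' I)).map (MulAut.conj w).toMonoidHom

/-- The simple generators `w s_i w⁻¹`, `i ∈ I`, of `w W_I w⁻¹`. -/
def parabolicSimples (cs : CoxeterSystem M W) (w : W) (I : Set B) : Set (parabolic cs w I) :=
  {x | ∃ i ∈ I, (x : W) = w * cs.simple i * w⁻¹}

/-- `P` is a parabolic subgroup of `W`, and `x` is a Coxeter element in `P`. -/
def IsCoxeterElementIn (cs : CoxeterSystem M W) (P : Subgroup W) (x : W) : Prop :=
  ∃ (w : W) (I : Set B), parabolic cs w I = P ∧
    ∃ x' : parabolic cs w I, IsCoxeterElement (parabolicSimples cs w I) x' ∧ (x' : W) = x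

end Parabolic

end KDivNC

/-! The argument rests on the moved space mov(w) = im(w − 1) in the geometric representation. It is
subadditive under products and a reflection moves at most a line, so dim mov(w) ≤ ℓ_T(w). Because
every root is positive or negative, membership in a parabolic subgroup is a condition on the moved
space (`mem_closure_iff_moved_le`). For finite W, a Coxeter element x of a parabolic P moves the
whole span of the roots of P (`moved_wordProd`). Hence ℓ_T(x) = dim mov(x) and P = {y : mov(y) ≤
mov(x)}, so x determines P.

Existence of W' comes from descending from c to π₁ one reflection at a time: if t is a reflection in
the parabolic of a Coxeter element, multiplying by t deletes one letter, up to conjugation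
(`exists_reflection_mul_wordProd`). The dimension count also puts everything below π₁ inside W',
where reflections, and therefore lengths and the order, agree with those of W
(`isCompatible_parabolic`).

The isomorphisms are then formal. Let δ_i and ε_i be the differences of π and μ. The differences of
the image of μ are conjugates of δ_i⁻¹ε_i, and the image runs from μ₁ to π₁. If δ_i ≤ ε_i for all i,
lengths subtract and the image is geodesic (`absLE_twist`). Conversely, if the image is geodesic,
adding lengths forces equality in every subadditivity estimate (`absLE_of_absLE_twist`). Statement 2
is statement 1 carried along the order-reversing bijection ∂. -/

namespace KDivNC

/-! ### The geometric representation -/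

section Geometry

variable {B : Type*} {M : CoxeterMatrix B} {W : Type*} [Group W]

/-- The coroot `v ↦ 2 B(α_i, v)` of the geometric representation. -/
noncomputable def coroot (M : CoxeterMatrix B) (i : B) : Module.Dual ℝ (B →₀ ℝ) :=
  Finsupp.linearCombination ℝ fun j => -2 * Real.cos (Real.pi / M i j)

/-- The simple root `α_i`. -/
noncomputable def simpleRoot (i : B) : B →₀ ℝ := Finsupp.single i 1

theorem coroot_simpleRoot (M : CoxeterMatrix B) (i j : B) :
    coroot M i (simpleRoot j) = -2 * Real.cos (Real.pi / M i j) := by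
  simp [coroot, simpleRoot]

theorem coroot_simpleRoot_self (M : CoxeterMatrix B) (i : B) :
    coroot M i (simpleRoot i) = 2 := by
  simp [coroot_simpleRoot]

theorem chebyshevS_mul_sin (θ : ℝ) (n : ℤ) :
    (Polynomial.Chebyshev.S ℝ n).eval (2 * Real.cos θ) * Real.sin θ =
      Real.sin ((n + 1) * θ) :=
  Polynomial.Chebyshev.S_two_mul_real_cos θ n

/-- In the plane of two simple roots with finite label m the product of the reflections rotates by
2π/m. Its powers have Chebyshev coefficients, which vanish at exponent m. -/
theorem isLiftable_reflection (M : CoxeterMatrix B) :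
    M.IsLiftable fun i => Module.reflection (coroot_simpleRoot_self M i) := by
  intro i j
  rcases eq_or_ne i j with rfl | hij
  · rw [M.diagonal i, pow_one]
    ext1 v
    exact Module.involutive_reflection (coroot_simpleRoot_self M i) v
  -- The label 0 (infinite order) imposes no relation. For label 2 the angle φ below would be π,
  -- with sin φ = 0, so the commutation is checked directly.
  rcases Nat.lt_or_ge (M i j) 3 with hm | hm
  · have h1 := M.off_diagonal i j hij
    have h3 : M i j = 0 ∨ M i j = 2 := by omega
    rcases h3 with h3 | h3
    · rw [h3, pow_zero]
    · have hf : coroot M i (simpleRoot j) = 0 := by simp [coroot_simpleRoot, h3]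
      have hg : coroot M j (simpleRoot i) = 0 := by simp [coroot_simpleRoot, M.symmetric j i, h3]
      rw [h3]
      ext1 v
      simp only [pow_two, LinearEquiv.mul_apply, Module.reflection_apply, map_sub, map_smul, hf, hg,
        coroot_simpleRoot_self, LinearEquiv.coe_one, id_eq]
      module
  · have hm0 : (M i j : ℝ) ≠ 0 := by positivity
    set φ : ℝ := 2 * (Real.pi / M i j) with hφ
    have hmφ : (M i j : ℝ) * φ = 2 * Real.pi := by rw [hφ]; field_simp
    have hsin : Real.sin φ ≠ 0 := by
      apply ne_of_gt
      apply Real.sin_pos_of_pos_of_lt_pi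
      · positivity
      · have : (3 : ℝ) ≤ M i j := by exact_mod_cast hm
        have := Real.pi_pos
        by_contra! h
        nlinarith
    have ht : 2 * Real.cos φ =
        coroot M i (simpleRoot j) * coroot M j (simpleRoot i) - 2 := by
      rw [coroot_simpleRoot, coroot_simpleRoot, M.symmetric j i, hφ, Real.cos_two_mul]
      ring
    -- The angles (a+1)φ and (b+1)φ add up to mφ = 2π, so their sines cancel.
    have hz : ∀ a b : ℤ, a + b + 2 = M i j →
        (Polynomial.Chebyshev.S ℝ a).eval (2 * Real.cos φ) +
          (Polynomial.Chebyshev.S ℝ b).eval (2 * Real.cos φ) = 0 := by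
      intro a b hab
      apply mul_right_cancel₀ hsin
      rw [add_mul, chebyshevS_mul_sin, chebyshevS_mul_sin, zero_mul]
      have : ((b : ℝ) + 1) * φ = 2 * Real.pi - (a + 1) * φ := by
        rw [← hmφ]
        have : (M i j : ℝ) = a + b + 2 := by exact_mod_cast hab.symm
        rw [this]; ring
      rw [this, Real.sin_two_pi_sub]
      ring
    have hz' : ∀ a : ℤ, a + a + 2 = M i j →
        (Polynomial.Chebyshev.S ℝ a).eval (2 * Real.cos φ) = 0 := by
      intro a ha
      have := hz a a ha
      linarith
    -- These products are the coefficients in `Module.reflection_mul_reflection_pow_apply`. The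
    -- first factor vanishes for even m, the second for odd m.
    have h1 : (Polynomial.Chebyshev.S ℝ (((M i j : ℕ) - 2 : ℤ) / 2)).eval (2 * Real.cos φ) *
        ((Polynomial.Chebyshev.S ℝ (((M i j : ℕ) - 1 : ℤ) / 2)).eval (2 * Real.cos φ) +
          (Polynomial.Chebyshev.S ℝ (((M i j : ℕ) - 3 : ℤ) / 2)).eval (2 * Real.cos φ)) = 0 := by
      rcases Nat.even_or_odd' (M i j) with ⟨p, hp | hp⟩
      · rw [hz' _ (by omega), zero_mul]
      · rw [hz _ _ (by omega), mul_zero]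
    have h2 : (Polynomial.Chebyshev.S ℝ (((M i j : ℕ) - 1 : ℤ) / 2)).eval (2 * Real.cos φ) *
        ((Polynomial.Chebyshev.S ℝ (((M i j : ℕ) : ℤ) / 2)).eval (2 * Real.cos φ) +
          (Polynomial.Chebyshev.S ℝ (((M i j : ℕ) - 2 : ℤ) / 2)).eval (2 * Real.cos φ)) = 0 := by
      rcases Nat.even_or_odd' (M i j) with ⟨p, hp | hp⟩
      · rw [hz' _ (by omega), zero_mul]
      · rw [hz _ _ (by omega), mul_zero]
    ext1 v
    rw [Module.reflection_mul_reflection_pow_apply _ _ _ _ _ ht, h1, h2]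
    simp

/-- The geometric representation. -/
noncomputable def geomRep (cs : CoxeterSystem M W) : W →* ((B →₀ ℝ) ≃ₗ[ℝ] (B →₀ ℝ)) :=
  cs.lift ⟨_, isLiftable_reflection M⟩

variable (cs : CoxeterSystem M W)

theorem geomRep_simple (i : B) (v : B →₀ ℝ) :
    geomRep cs (cs.simple i) v = v - coroot M i v • simpleRoot i := by
  rw [geomRep, cs.lift_apply_simple, Module.reflection_apply]

theorem geomRep_mul (x y : W) (v : B →₀ ℝ) :
    geomRep cs (x * y) v = geomRep cs x (geomRep cs y v) := by
  rw [map_mul, LinearEquiv.mul_apply]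

theorem geomRep_inv_self (x : W) (v : B →₀ ℝ) :
    geomRep cs x⁻¹ (geomRep cs x v) = v := by
  rw [← geomRep_mul, inv_mul_cancel, map_one]; rfl

theorem geomRep_self_inv (x : W) (v : B →₀ ℝ) :
    geomRep cs x (geomRep cs x⁻¹ v) = v := by
  rw [← geomRep_mul, mul_inv_cancel, map_one]; rfl

theorem geomRep_simple_simpleRoot (i : B) :
    geomRep cs (cs.simple i) (simpleRoot i) = -simpleRoot i := by
  rw [geomRep_simple, coroot_simpleRoot_self, two_smul]
  abel

theorem geomRep_mul_simple_simpleRoot (w : W) (i : B) :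
    geomRep cs (w * cs.simple i) (simpleRoot i) = -geomRep cs w (simpleRoot i) := by
  rw [geomRep_mul, geomRep_simple_simpleRoot, map_neg]

/-! ### Every root is positive or negative -/

/-- Applying the next letter is one step of the recurrence. Leaving u free, with the factor `u 1` in
place of a division, covers sin(nπ/m) and, for infinite order, n. -/
theorem geomRep_alternatingWord (i j : B) (u : ℕ → ℝ) (h0 : u 0 = 0)
    (hu : ∀ n, u (n + 2) = 2 * Real.cos (Real.pi / M i j) * u (n + 1) - u n) (n : ℕ) :
    u 1 • geomRep cs (cs.wordProd (CoxeterSystem.alternatingWord i j n)) (simpleRoot i) =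
      if Even n then u (n + 1) • simpleRoot i + u n • simpleRoot j
      else u n • simpleRoot i + u (n + 1) • simpleRoot j := by
  induction n with
  | zero => simp [CoxeterSystem.alternatingWord, h0]
  | succ n ih =>
    rw [CoxeterSystem.alternatingWord_succ', cs.wordProd_cons, geomRep_mul, ← map_smul, ih]
    by_cases hn : Even n
    · have hn' : ¬ Even (n + 1) := by simpa [Nat.even_add_one] using hn
      rw [if_pos hn, if_pos hn, if_neg hn', geomRep_simple, map_add, map_smul, map_smul,
        coroot_simpleRoot_self, coroot_simpleRoot, M.symmetric j i, hu, smul_eq_mul, smul_eq_mul]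
      module
    · have hn' : Even (n + 1) := by simpa [Nat.even_add_one] using hn
      rw [if_neg hn, if_neg hn, if_pos hn', geomRep_simple, map_add, map_smul, map_smul,
        coroot_simpleRoot_self, coroot_simpleRoot, hu, smul_eq_mul, smul_eq_mul]
      module

theorem geomRep_alternatingWord_nonneg {i j : B} (hij : i ≠ j) (n : ℕ)
    (hn : M i j = 0 ∨ n < M i j) :
    ∃ a b : ℝ, 0 ≤ a ∧ 0 ≤ b ∧
      geomRep cs (cs.wordProd (CoxeterSystem.alternatingWord i j n)) (simpleRoot i) =
        a • simpleRoot i + b • simpleRoot j := by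
  obtain ⟨u, h0, h1, hu, hpos⟩ : ∃ u : ℕ → ℝ, u 0 = 0 ∧ 0 < u 1 ∧
      (∀ n, u (n + 2) = 2 * Real.cos (Real.pi / M i j) * u (n + 1) - u n) ∧
      0 ≤ u n ∧ 0 ≤ u (n + 1) := by
    rcases hn with h | h
    -- Here π / 0 = 0, so the cosine is 1 and the recurrence is solved by n.
    · refine ⟨fun n => n, by simp, by simp, fun n => ?_, by positivity, by positivity⟩
      simp [h]; ring
    · have h2 : 2 ≤ M i j := by
        have := M.off_diagonal i j hij
        omega
      have hM : (0 : ℝ) < M i j := by positivity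
      have hpi := Real.pi_pos
      have key : ∀ k : ℕ, k ≤ M i j → 0 ≤ Real.sin (k * (Real.pi / M i j)) := by
        intro k hk
        apply Real.sin_nonneg_of_nonneg_of_le_pi (by positivity)
        have : (k : ℝ) ≤ M i j := by exact_mod_cast hk
        calc (k : ℝ) * (Real.pi / M i j) ≤ M i j * (Real.pi / M i j) := by gcongr
          _ = Real.pi := by field_simp
      refine ⟨fun n => Real.sin (n * (Real.pi / M i j)), by simp, ?_, fun n => ?_,
        key _ (by omega), key _ (by omega)⟩
      · simp only [Nat.cast_one, one_mul]
        apply Real.sin_pos_of_pos_of_lt_pi (by positivity)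
        rw [div_lt_iff₀ hM]
        have : (2 : ℝ) ≤ M i j := by exact_mod_cast h2
        nlinarith
      · set θ := Real.pi / M i j
        have e1 : ((n + 2 : ℕ) : ℝ) * θ = ((n + 1 : ℕ) : ℝ) * θ + θ := by push_cast; ring
        have e2 : (n : ℝ) * θ = ((n + 1 : ℕ) : ℝ) * θ - θ := by push_cast; ring
        beta_reduce
        rw [e1, e2, Real.sin_add, Real.sin_sub]
        ring
  have h := geomRep_alternatingWord cs i j u h0 hu n
  have h' := congrArg (fun v => (u 1)⁻¹ • v) h
  simp only [inv_smul_smul₀ h1.ne'] at h'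
  rw [h']
  have hinv : 0 ≤ (u 1)⁻¹ := by positivity
  by_cases he : Even n
  · exact ⟨(u 1)⁻¹ * u (n + 1), (u 1)⁻¹ * u n, mul_nonneg hinv hpos.2, mul_nonneg hinv hpos.1, by
      rw [if_pos he, smul_add, smul_smul, smul_smul]⟩
  · exact ⟨(u 1)⁻¹ * u n, (u 1)⁻¹ * u (n + 1), mul_nonneg hinv hpos.1, mul_nonneg hinv hpos.2, by
      rw [if_neg he, smul_add, smul_smul, smul_smul]⟩

/-- Reduction to rank two: choose a right descent j and factor w, with lengths adding, as v times an
alternating word in i and j, with v shortest. Then v has neither i nor j as a descent, so induction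
applies to v, and the alternating word sends α_i to a nonnegative combination of α_i and α_j. -/
theorem geomRep_simpleRoot_nonneg (w : W) (i : B) (h : ¬ cs.IsRightDescent w i) :
    0 ≤ geomRep cs w (simpleRoot i) := by
  induction hn : cs.length w using Nat.strong_induction_on generalizing w i with
  | _ n ih =>
  subst hn
  by_cases hw : w = 1
  · subst hw
    simp [simpleRoot]
  obtain ⟨j, hj⟩ := cs.exists_rightDescent_of_ne_one hw
  have hij : i ≠ j := fun e => h (e ▸ hj)
  let A : Set W := {v | ∃ n, w = v * cs.wordProd (CoxeterSystem.alternatingWord i j n) ∧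
    cs.length v + n = cs.length w}
  have hA1 : w * cs.simple j ∈ A := by
    refine ⟨1, by simp [CoxeterSystem.alternatingWord], ?_⟩
    exact cs.isRightDescent_iff.1 hj
  obtain ⟨v, ⟨n, hv, hvl⟩, hmin⟩ : ∃ v ∈ A, ∀ v' ∈ A, cs.length v ≤ cs.length v' := by
    obtain ⟨v, hv, hm⟩ := (measure cs.length).wf.has_min A ⟨_, hA1⟩
    exact ⟨v, hv, fun v' hv' => not_lt.1 (hm v' hv')⟩
  have hlt : cs.length v < cs.length w :=
    lt_of_le_of_lt (hmin _ hA1) hj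
  have hwl : ∀ (l : List B), cs.length (cs.wordProd l) ≤ l.length := cs.length_wordProd_le
  obtain ⟨n, rfl⟩ : ∃ m, n = m + 1 := ⟨n - 1, by omega⟩
  have hdesc : ¬ cs.IsRightDescent v i ∧ ¬ cs.IsRightDescent v j := by
    -- The letter y begins the alternating word, so a descent y of v would shorten w. The letter x
    -- would prolong the word, so a descent x would contradict minimality of v.
    have key : ∀ x y, (if Even n then j else i) = y →
        (if Even (n + 1) then j else i) = x →
        ¬ cs.IsRightDescent v y ∧ ¬ cs.IsRightDescent v x := by
      intro x y hy hx
      constructor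
      · intro hd
        have h1 := cs.isRightDescent_iff.1 hd
        have e : w = v * cs.simple y * cs.wordProd (CoxeterSystem.alternatingWord i j n) := by
          rw [hv, CoxeterSystem.alternatingWord_succ', hy, cs.wordProd_cons, mul_assoc]
        have h2 := cs.length_mul_le (v * cs.simple y)
          (cs.wordProd (CoxeterSystem.alternatingWord i j n))
        rw [← e] at h2
        have h3 := hwl (CoxeterSystem.alternatingWord i j n)
        rw [CoxeterSystem.length_alternatingWord] at h3
        omega
      · intro hd
        have h1 := cs.isRightDescent_iff.1 hd
        have := hmin (v * cs.simple x) ⟨n + 2, by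
          rw [hv, CoxeterSystem.alternatingWord_succ' i j (n + 1), hx, cs.wordProd_cons,
            ← mul_assoc, cs.simple_mul_simple_cancel_right], by omega⟩
        omega
    by_cases he : Even n
    · have he' : ¬ Even (n + 1) := by simpa [Nat.even_add_one] using he
      obtain ⟨h1, h2⟩ := key i j (if_pos he) (if_neg he')
      exact ⟨h2, h1⟩
    · have he' : Even (n + 1) := by simpa [Nat.even_add_one] using he
      exact key j i (if_neg he) (if_pos he')
  -- An alternating word longer than m is not reduced. One of length m can be braided to end in i,
  -- which would make i a descent of w.
  have hnM : M i j = 0 ∨ n + 1 < M i j := by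
    by_contra! hcon
    obtain ⟨hM0, hM⟩ := hcon
    apply h
    have hle : n + 1 ≤ M i j := by
      by_contra! hgt
      have h1 := cs.not_isReduced_alternatingWord i j hM0 hgt
      apply h1
      have h2 := cs.length_mul_le v (cs.wordProd (CoxeterSystem.alternatingWord i j (n + 1)))
      have h3 := hwl (CoxeterSystem.alternatingWord i j (n + 1))
      rw [← hv] at h2
      rw [CoxeterSystem.length_alternatingWord] at h3
      rw [CoxeterSystem.IsReduced, CoxeterSystem.length_alternatingWord]
      omega
    have heq : n + 1 = M i j := le_antisymm hle hM
    have hb : cs.wordProd (CoxeterSystem.alternatingWord i j (n + 1)) =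
        cs.wordProd (CoxeterSystem.alternatingWord j i (n + 1)) := by
      have := cs.wordProd_braidWord_eq i j
      rwa [CoxeterSystem.braidWord, CoxeterSystem.braidWord, M.symmetric j i, ← heq] at this
    rw [hb, CoxeterSystem.alternatingWord_succ, cs.wordProd_concat, ← mul_assoc] at hv
    rw [cs.isRightDescent_iff, hv, cs.simple_mul_simple_cancel_right, ← hv]
    have h2 := cs.length_mul_le v (cs.wordProd (CoxeterSystem.alternatingWord i j n))
    have h3 := hwl (CoxeterSystem.alternatingWord i j n)
    have h4 := cs.length_mul_le (v * cs.wordProd (CoxeterSystem.alternatingWord i j n))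
      (cs.simple i)
    rw [← hv, cs.length_simple] at h4
    rw [CoxeterSystem.length_alternatingWord] at h3
    omega
  obtain ⟨a, b, ha, hb, hab⟩ := geomRep_alternatingWord_nonneg cs hij (n + 1) hnM
  have h1 := ih _ hlt v i hdesc.1 rfl
  have h2 := ih _ hlt v j hdesc.2 rfl
  rw [hv, geomRep_mul, hab, map_add, map_smul, map_smul]
  exact add_nonneg (smul_nonneg ha h1) (smul_nonneg hb h2)

theorem geomRep_simpleRoot_nonpos (w : W) (i : B) (h : cs.IsRightDescent w i) :
    geomRep cs w (simpleRoot i) ≤ 0 := by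
  rw [cs.isRightDescent_iff_not_isRightDescent_mul] at h
  have h1 := geomRep_simpleRoot_nonneg cs _ i h
  rw [geomRep_mul_simple_simpleRoot] at h1
  exact neg_nonneg.1 h1

theorem geomRep_simpleRoot_nonneg_or_nonpos (w : W) (i : B) :
    0 ≤ geomRep cs w (simpleRoot i) ∨ geomRep cs w (simpleRoot i) ≤ 0 := by
  by_cases h : cs.IsRightDescent w i
  · exact Or.inr (geomRep_simpleRoot_nonpos cs w i h)
  · exact Or.inl (geomRep_simpleRoot_nonneg cs w i h)

end Geometry

section Moved

variable {B : Type*} {M : CoxeterMatrix B} {W : Type*} [Group W] (cs : CoxeterSystem M W)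

/-! ### The moved space -/

/-- The moved space `im (w - 1)` of `w` in the geometric representation. -/
noncomputable def moved (w : W) : Submodule ℝ (B →₀ ℝ) :=
  LinearMap.range ((geomRep cs w : (B →₀ ℝ) →ₗ[ℝ] (B →₀ ℝ)) - LinearMap.id)

theorem sub_mem_moved (w : W) (v : B →₀ ℝ) : geomRep cs w v - v ∈ moved cs w :=
  ⟨v, by simp⟩

theorem moved_le_iff {w : W} {U : Submodule ℝ (B →₀ ℝ)} :
    moved cs w ≤ U ↔ ∀ v, geomRep cs w v - v ∈ U := by
  constructor
  · exact fun h v => h (sub_mem_moved cs w v)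
  · rintro h _ ⟨v, rfl⟩
    simpa using h v

theorem moved_one : moved cs (1 : W) = ⊥ := by
  rw [eq_bot_iff, moved_le_iff]
  intro v
  rw [map_one]
  simp

theorem moved_mul_le (x y : W) : moved cs (x * y) ≤ moved cs x ⊔ moved cs y := by
  rw [moved_le_iff]
  intro v
  rw [geomRep_mul, ← sub_add_sub_cancel _ (geomRep cs y v)]
  exact Submodule.add_mem_sup (sub_mem_moved cs x _) (sub_mem_moved cs y v)

theorem moved_inv_le (x : W) : moved cs x⁻¹ ≤ moved cs x := by
  rw [moved_le_iff]
  intro v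
  have h := sub_mem_moved cs x (geomRep cs x⁻¹ v)
  rw [geomRep_self_inv] at h
  simpa using neg_mem h

theorem moved_simple_le (i : B) : moved cs (cs.simple i) ≤ Submodule.span ℝ {simpleRoot i} := by
  rw [moved_le_iff]
  intro v
  rw [geomRep_simple, sub_sub_cancel_left]
  exact neg_mem (Submodule.smul_mem _ _ (Submodule.mem_span_singleton_self _))

theorem moved_conj (g x : W) : moved cs (g * x * g⁻¹) =
    (moved cs x).map (geomRep cs g : (B →₀ ℝ) →ₗ[ℝ] (B →₀ ℝ)) := by
  apply le_antisymm
  · rw [moved_le_iff]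
    intro v
    refine ⟨_, sub_mem_moved cs x (geomRep cs g⁻¹ v), ?_⟩
    simp
  · rw [Submodule.map_le_iff_le_comap, moved_le_iff]
    intro v
    have h := sub_mem_moved cs (g * x * g⁻¹) (geomRep cs g v)
    rw [geomRep_mul, geomRep_inv_self, geomRep_mul] at h
    simpa using h

theorem simpleRoot_mem_supported {I : Set B} {i : B} (hi : i ∈ I) :
    simpleRoot i ∈ Finsupp.supported ℝ ℝ I :=
  Finsupp.single_mem_supported ℝ 1 hi

theorem simpleRoot_ne_zero (i : B) : simpleRoot i ≠ 0 := by
  simp [simpleRoot]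

theorem moved_le_supported_of_mem {I : Set B} {w : W}
    (hw : w ∈ Subgroup.closure (cs.simple '' I)) : moved cs w ≤ Finsupp.supported ℝ ℝ I := by
  induction hw using Subgroup.closure_induction with
  | mem x hx =>
    obtain ⟨i, hi, rfl⟩ := hx
    refine (moved_simple_le cs i).trans ?_
    rw [Submodule.span_singleton_le_iff_mem]
    exact simpleRoot_mem_supported hi
  | one => rw [moved_one]; exact bot_le
  | mul x y _ _ hx hy => exact (moved_mul_le cs x y).trans (sup_le hx hy)
  | inv x _ hx => exact (moved_inv_le cs x).trans hx

/-- For the converse, a right descent j makes w α_j ≤ 0, so w α_j − α_j has coefficient at most −1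
at j. This forces j ∈ I, and the letter can be stripped off. -/
theorem mem_closure_iff_moved_le {I : Set B} {w : W} :
    w ∈ Subgroup.closure (cs.simple '' I) ↔ moved cs w ≤ Finsupp.supported ℝ ℝ I := by
  refine ⟨moved_le_supported_of_mem cs, ?_⟩
  induction hn : cs.length w using Nat.strong_induction_on generalizing w with
  | _ n ih =>
  subst hn
  intro hw
  by_cases h1 : w = 1
  · rw [h1]; exact one_mem _
  obtain ⟨j, hj⟩ := cs.exists_rightDescent_of_ne_one h1
  have hjI : j ∈ I := by
    by_contra hjI
    have h2 := (moved_le_iff cs).1 hw (simpleRoot j)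
    rw [Finsupp.mem_supported'] at h2
    have h3 := h2 j hjI
    have h4 := geomRep_simpleRoot_nonpos cs w j hj j
    simp only [Finsupp.coe_sub, Pi.sub_apply, simpleRoot, Finsupp.single_eq_same,
      Finsupp.coe_zero, Pi.zero_apply] at h3 h4
    linarith
  have hs : cs.simple j ∈ Subgroup.closure (cs.simple '' I) :=
    Subgroup.subset_closure ⟨j, hjI, rfl⟩
  have h5 := ih _ hj rfl ((moved_mul_le cs w (cs.simple j)).trans
    (sup_le hw (moved_le_supported_of_mem cs hs)))
  have h6 := mul_mem h5 hs
  rwa [cs.simple_mul_simple_cancel_right] at h6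

theorem simple_injective : Function.Injective cs.simple := by
  intro i j h
  by_contra hij
  have h1 := geomRep_simple_simpleRoot cs i
  rw [h, geomRep_simple] at h1
  have h2 := congrArg (fun v : B →₀ ℝ => v i) h1
  simp [simpleRoot, Ne.symm hij] at h2
  norm_num at h2

/-- The reflection s_k changes only the coordinate k, so a positive root that it makes negative is
supported on k. The conjugate therefore lies in {1, s_k}, and it is not 1. -/
theorem conj_eq_simple {x : W} {i k : B} (h1 : 0 ≤ geomRep cs x (simpleRoot i))
    (h2 : geomRep cs (cs.simple k * x) (simpleRoot i) ≤ 0) :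
    x * cs.simple i * x⁻¹ = cs.simple k := by
  have hmem : x * cs.simple i * x⁻¹ ∈ Subgroup.closure (cs.simple '' {k}) := by
    rw [mem_closure_iff_moved_le, moved_conj]
    refine (Submodule.map_mono (moved_simple_le cs i)).trans ?_
    rw [Submodule.map_span_le]
    rintro _ rfl
    rw [Finsupp.mem_supported']
    intro b hb
    have h3 := h1 b
    have h4 := h2 b
    rw [geomRep_mul, geomRep_simple] at h4
    have h5 : (simpleRoot k : B →₀ ℝ) b = 0 := by
      simp only [simpleRoot]
      exact Finsupp.single_eq_of_ne hb
    simp [h5] at h3 h4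
    exact le_antisymm h4 h3
  have hor : x * cs.simple i * x⁻¹ = 1 ∨ x * cs.simple i * x⁻¹ = cs.simple k := by
    generalize x * cs.simple i * x⁻¹ = y at hmem
    induction hmem using Subgroup.closure_induction with
    | mem x hx => right; simpa using hx
    | one => left; rfl
    | mul x y _ _ hx hy =>
      rcases hx with rfl | rfl <;> rcases hy with rfl | rfl <;> simp
    | inv x _ hx => rcases hx with rfl | rfl <;> simp
  refine hor.resolve_left fun h => ?_
  have h5 : cs.simple i = 1 := by
    rwa [mul_inv_eq_one, mul_eq_left] at h
  have h6 := cs.length_simple i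
  rw [h5, cs.length_one] at h6
  omega

/-- The exchange argument: as the letters act one after another, the root must change sign at one of
them. -/
theorem exists_split_of_nonneg_of_nonpos (ω : List B) (u : W) (i : B)
    (h1 : 0 ≤ geomRep cs u (simpleRoot i))
    (h2 : geomRep cs (cs.wordProd ω * u) (simpleRoot i) ≤ 0) :
    ∃ ω₁ k ω₂, ω = ω₁ ++ k :: ω₂ ∧
      (cs.wordProd ω₂ * u) * cs.simple i * (cs.wordProd ω₂ * u)⁻¹ = cs.simple k := by
  induction ω with
  | nil =>
    exfalso
    rw [cs.wordProd_nil, one_mul] at h2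
    exact simpleRoot_ne_zero i (by simpa using le_antisymm h2 h1)
  | cons k ω ih =>
    rcases geomRep_simpleRoot_nonneg_or_nonpos cs (cs.wordProd ω * u) i with h | h
    · refine ⟨[], k, ω, rfl, conj_eq_simple cs h ?_⟩
      rwa [← mul_assoc, ← cs.wordProd_cons]
    · obtain ⟨ω₁, k', ω₂, h3, h4⟩ := ih h
      exact ⟨k :: ω₁, k', ω₂, by rw [h3]; rfl, h4⟩

theorem exists_wordProd_of_mem_closure {I : Set B} {w : W}
    (hw : w ∈ Subgroup.closure (cs.simple '' I)) :
    ∃ ω : List B, (∀ i ∈ ω, i ∈ I) ∧ w = cs.wordProd ω := by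
  induction hw using Subgroup.closure_induction with
  | mem x hx =>
    obtain ⟨i, hi, rfl⟩ := hx
    exact ⟨[i], by simpa using hi, by simp⟩
  | one => exact ⟨[], by simp, by simp⟩
  | mul x y _ _ hx hy =>
    obtain ⟨a, ha, rfl⟩ := hx
    obtain ⟨b, hb, rfl⟩ := hy
    refine ⟨a ++ b, ?_, (cs.wordProd_append a b).symm⟩
    intro i hi
    rcases List.mem_append.1 hi with h | h
    exacts [ha i h, hb i h]
  | inv x _ hx =>
    obtain ⟨a, ha, rfl⟩ := hx
    exact ⟨a.reverse, by simpa using ha, (cs.wordProd_reverse a).symm⟩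

theorem wordProd_mem_closure {I : Set B} {ω : List B} (hω : ∀ i ∈ ω, i ∈ I) :
    cs.wordProd ω ∈ Subgroup.closure (cs.simple '' I) := by
  apply Subgroup.list_prod_mem
  intro x hx
  obtain ⟨i, hi, rfl⟩ := List.mem_map.1 hx
  exact Subgroup.subset_closure ⟨i, hω i hi, rfl⟩

theorem mul_simple_conj (x : W) (j : B) :
    x * cs.simple j * cs.simple j * (x * cs.simple j)⁻¹ = x * cs.simple j * x⁻¹ := by
  rw [mul_inv_rev, cs.inv_simple, ← mul_assoc, cs.simple_mul_simple_cancel_right]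

/-- A reflection that lies in a standard parabolic subgroup is a reflection of that subgroup. -/
theorem exists_conj_simple_of_mem_closure {I : Set B} {t : W} (ht : t ∈ reflections (simples cs))
    (htI : t ∈ Subgroup.closure (cs.simple '' I)) :
    ∃ u ∈ Subgroup.closure (cs.simple '' I), ∃ i ∈ I, t = u * cs.simple i * u⁻¹ := by
  obtain ⟨x, j, rfl, hx⟩ : ∃ x j, t = x * cs.simple j * x⁻¹ ∧
      0 ≤ geomRep cs x (simpleRoot j) := by
    obtain ⟨_, ⟨j, rfl⟩, x, rfl⟩ := ht
    rcases geomRep_simpleRoot_nonneg_or_nonpos cs x j with h | h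
    · exact ⟨x, j, rfl, h⟩
    · refine ⟨x * cs.simple j, j, (mul_simple_conj cs x j).symm, ?_⟩
      rw [geomRep_mul_simple_simpleRoot]
      exact neg_nonneg.2 h
  obtain ⟨ω, hω, e⟩ := exists_wordProd_of_mem_closure cs htI
  -- The reflection t negates its own root x α_j, so the sign changes at some letter of a word for t
  -- in I.
  obtain ⟨ω₁, k, ω₂, rfl, h⟩ := exists_split_of_nonneg_of_nonpos cs ω x j hx (by
    rw [← e, inv_mul_cancel_right, geomRep_mul_simple_simpleRoot]
    exact neg_nonpos.2 hx)
  refine ⟨(cs.wordProd ω₂)⁻¹, inv_mem (wordProd_mem_closure cs fun i hi => hω i (by simp [hi])),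
    k, hω k (by simp), ?_⟩
  rw [← h]
  group

/-! ### Standard Coxeter elements -/

theorem geomRep_eq_self_of_mem_closure {I : Set B} {v : B →₀ ℝ} (hv : ∀ i ∈ I, coroot M i v = 0)
    {w : W} (hw : w ∈ Subgroup.closure (cs.simple '' I)) : geomRep cs w v = v := by
  induction hw using Subgroup.closure_induction with
  | mem x hx =>
    obtain ⟨i, hi, rfl⟩ := hx
    rw [geomRep_simple, hv i hi, zero_smul, sub_zero]
  | one => rw [map_one]; rfl
  | mul x y _ _ hx hy => rw [geomRep_mul, hy, hx]
  | inv x _ hx =>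
    conv_lhs => rw [← hx]
    exact geomRep_inv_self cs x v

/-- Averaging over W_I takes the place of positive definiteness. The sum over W_I kills each α_i
with i ∈ I, as reindexing by s_i changes its sign, but it multiplies the fixed vector v by |W_I|. -/
theorem eq_zero_of_coroot_eq_zero (cs : CoxeterSystem M W) [Finite W] {I : Set B} {v : B →₀ ℝ}
    (hvI : v ∈ Finsupp.supported ℝ ℝ I) (hv : ∀ i ∈ I, coroot M i v = 0) : v = 0 := by
  classical
  set H := Subgroup.closure (cs.simple '' I) with hH
  have : Fintype H := Fintype.ofFinite _
  let A : (B →₀ ℝ) →ₗ[ℝ] (B →₀ ℝ) :=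
    ∑ w : H, (geomRep cs (w : W) : (B →₀ ℝ) →ₗ[ℝ] (B →₀ ℝ))
  have hA : ∀ x, A x = ∑ w : H, geomRep cs (w : W) x := fun x => by simp [A]
  have hA0 : Finsupp.supported ℝ ℝ I ≤ LinearMap.ker A := by
    rw [Finsupp.supported_eq_span_single, Submodule.span_le]
    rintro _ ⟨i, hi, rfl⟩
    rw [SetLike.mem_coe, LinearMap.mem_ker]
    have hs : cs.simple i ∈ H := Subgroup.subset_closure ⟨i, hi, rfl⟩
    have h : A (simpleRoot i) = -A (simpleRoot i) := by
      rw [hA, ← Finset.sum_neg_distrib]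
      refine Fintype.sum_equiv (Equiv.mulRight (⟨cs.simple i, hs⟩ : H)) _ _ fun w => ?_
      simp [geomRep_simple_simpleRoot]
    exact self_eq_neg.1 h
  have h1 : A v = (Fintype.card H : ℝ) • v := by
    rw [hA, Finset.sum_congr rfl fun w _ => geomRep_eq_self_of_mem_closure cs hv w.2]
    simp [← Nat.cast_smul_eq_nsmul ℝ]
  rw [LinearMap.mem_ker.1 (hA0 hvI)] at h1
  exact (smul_eq_zero.1 h1.symm).resolve_left (by simp)

/-- If s_i y v = v then y v = s_i v. The left side differs from v only in coordinates of the later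
letters, the right side only in coordinate i, so neither differs. -/
theorem coroot_eq_zero_of_wordProd_fixed {l : List B} (hl : l.Nodup) {v : B →₀ ℝ}
    (hv : geomRep cs (cs.wordProd l) v = v) : ∀ i ∈ l, coroot M i v = 0 := by
  induction l with
  | nil => simp
  | cons i l ih =>
    obtain ⟨hi, hl⟩ := List.nodup_cons.1 hl
    rw [cs.wordProd_cons, geomRep_mul] at hv
    have h1 := congrArg (geomRep cs (cs.simple i)) hv
    rw [← geomRep_mul, cs.simple_mul_simple_self, map_one, geomRep_simple] at h1
    have h2 : geomRep cs (cs.wordProd l) v = v - coroot M i v • simpleRoot i := h1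
    have h3 := moved_le_supported_of_mem cs (wordProd_mem_closure cs (I := {i | i ∈ l})
      fun _ h => h) (sub_mem_moved cs (cs.wordProd l) v)
    rw [h2, Finsupp.mem_supported'] at h3
    have h4 := h3 i hi
    have h5 : coroot M i v = 0 := by simpa [simpleRoot] using h4
    rw [h5, zero_smul, sub_zero] at h2
    simp only [List.mem_cons, forall_eq_or_imp]
    exact ⟨h5, ih hl h2⟩

/-- The product fixes no nonzero vector in the span of its simple roots, so subtracting the identity
is injective there, and equality follows by dimension. -/
theorem moved_wordProd [Finite B] [Finite W] {l : List B} (hl : l.Nodup) :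
    moved cs (cs.wordProd l) = Finsupp.supported ℝ ℝ {i | i ∈ l} := by
  apply le_antisymm
  · exact moved_le_supported_of_mem cs (wordProd_mem_closure cs fun _ h => h)
  · set V := Finsupp.supported ℝ ℝ {i | i ∈ l}
    set φ := ((geomRep cs (cs.wordProd l) : (B →₀ ℝ) →ₗ[ℝ] (B →₀ ℝ)) - LinearMap.id).domRestrict V
      with hφ
    have hinj : Function.Injective φ := by
      rw [injective_iff_map_eq_zero]
      rintro ⟨v, hv⟩ h
      have h1 : geomRep cs (cs.wordProd l) v = v := by
        simpa [hφ, sub_eq_zero] using h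
      have := eq_zero_of_coroot_eq_zero cs hv (coroot_eq_zero_of_wordProd_fixed cs hl h1)
      simpa using this
    have hle : LinearMap.range φ ≤ V := by
      rintro _ ⟨v, rfl⟩
      exact moved_le_supported_of_mem cs (wordProd_mem_closure cs fun _ h => h)
        (sub_mem_moved cs _ v.1)
    have heq := Submodule.eq_of_le_of_finrank_eq hle (LinearMap.finrank_range_of_inj hinj)
    rw [← heq]
    rintro _ ⟨v, rfl⟩
    exact sub_mem_moved cs _ v.1

theorem finrank_supported_list {l : List B} (hl : l.Nodup) :
    Module.finrank ℝ (Finsupp.supported ℝ ℝ {i | i ∈ l} : Submodule ℝ (B →₀ ℝ)) = l.length := by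
  classical
  have : Fintype {i | i ∈ l} := Fintype.ofFinset l.toFinset (by simp)
  rw [(Finsupp.supportedEquivFinsupp (M := ℝ) (R := ℝ) {i | i ∈ l}).finrank_eq,
    Module.finrank_finsupp_self, Fintype.card_of_subtype l.toFinset (by simp),
    List.toFinset_card_of_nodup hl]

theorem finrank_moved_le_absLength [Finite B] (w : W) :
    Module.finrank ℝ (moved cs w) ≤ absLength (simples cs) w := by
  obtain ⟨l, hl, rfl, hlen⟩ := exists_min_word (S := simples cs)
    cs.submonoid_closure_range_simple w
  rw [← hlen]
  clear hlen
  induction l with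
  | nil => rw [List.prod_nil, moved_one]; simp
  | cons t l ih =>
    have h1 := ih fun t ht => hl t (by simp [ht])
    obtain ⟨_, ⟨i, rfl⟩, g, rfl⟩ := hl t (by simp)
    rw [List.prod_cons, List.length_cons]
    have h2 := Submodule.finrank_mono (moved_mul_le cs (g * cs.simple i * g⁻¹) l.prod)
    have h3 := Submodule.finrank_add_le_finrank_add_finrank
      (moved cs (g * cs.simple i * g⁻¹)) (moved cs l.prod)
    have h4 : Module.finrank ℝ (moved cs (g * cs.simple i * g⁻¹)) ≤ 1 := by
      rw [moved_conj]
      refine (Submodule.finrank_map_le _ _).trans ?_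
      refine (Submodule.finrank_mono (moved_simple_le cs i)).trans ?_
      exact (finrank_span_le_card _).trans (by simp)
    omega

/-- The sum of mov(x) and mov(x⁻¹c) contains mov(c) and has dimension at most ℓ_T(x) + ℓ_T(x⁻¹c) =
ℓ_T(c) = dim mov(c), so it equals mov(c). -/
theorem moved_le_of_absLE [Finite B] {x c : W} (h : AbsLE (simples cs) x c)
    (hc : absLength (simples cs) c = Module.finrank ℝ (moved cs c)) :
    moved cs x ≤ moved cs c := by
  have h1 := moved_mul_le cs x (x⁻¹ * c)
  rw [mul_inv_cancel_left] at h1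
  have h2 := Submodule.finrank_add_le_finrank_add_finrank (moved cs x) (moved cs (x⁻¹ * c))
  have h3 := finrank_moved_le_absLength cs x
  have h4 := finrank_moved_le_absLength cs (x⁻¹ * c)
  rw [AbsLE] at h
  rw [Submodule.eq_of_le_of_finrank_le h1 (by omega)]
  exact le_sup_left

/-! ### Deleting a reflection from a standard Coxeter element -/

/-- The sum of the c⁻¹-orbit of the root is fixed by c, hence zero. The roots in the orbit cannot
all be positive, so the sign changes from one power to the next. -/
theorem exists_pow_nonneg_nonpos [Finite W] {l : List B} (hl : l.Nodup) {u : W} {i : B}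
    (hi : i ∈ l) (hu : u ∈ Subgroup.closure (cs.simple '' {i | i ∈ l}))
    (h0 : 0 ≤ geomRep cs u (simpleRoot i)) :
    ∃ n : ℕ, 0 ≤ geomRep cs ((cs.wordProd l)⁻¹ ^ n * u) (simpleRoot i) ∧
      geomRep cs ((cs.wordProd l)⁻¹ ^ (n + 1) * u) (simpleRoot i) ≤ 0 := by
  by_contra! hcon
  set c := cs.wordProd l
  have hpos : ∀ n : ℕ, 0 ≤ geomRep cs (c⁻¹ ^ n * u) (simpleRoot i) := by
    intro n
    induction n with
    | zero => simpa using h0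
    | succ n ih =>
      exact (geomRep_simpleRoot_nonneg_or_nonpos cs _ i).resolve_right (hcon n ih)
  set N := orderOf c⁻¹ with hN
  have hNpos : 0 < N := orderOf_pos _
  set v := ∑ n ∈ Finset.range N, geomRep cs (c⁻¹ ^ n * u) (simpleRoot i) with hv
  have hfix : geomRep cs c⁻¹ v = v := by
    have h1 : geomRep cs c⁻¹ v =
        ∑ n ∈ Finset.range N, geomRep cs (c⁻¹ ^ (n + 1) * u) (simpleRoot i) := by
      rw [hv, map_sum]
      refine Finset.sum_congr rfl fun n _ => ?_
      rw [← geomRep_mul, ← mul_assoc, ← pow_succ']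
    have h2 := Finset.sum_range_succ' (fun n => geomRep cs (c⁻¹ ^ n * u) (simpleRoot i)) N
    rw [Finset.sum_range_succ, hN, pow_orderOf_eq_one, pow_zero, add_left_inj] at h2
    rw [h1, ← hN] at *
    exact h2.symm
  have hfix' : geomRep cs c v = v := by
    conv_lhs => rw [← hfix]
    exact geomRep_self_inv cs c v
  have hmem : v ∈ Finsupp.supported ℝ ℝ {i | i ∈ l} := by
    refine Submodule.sum_mem _ fun n _ => ?_
    have hx : c⁻¹ ^ n * u ∈ Subgroup.closure (cs.simple '' {i | i ∈ l}) :=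
      mul_mem (pow_mem (inv_mem (wordProd_mem_closure cs fun _ h => h)) n) hu
    have h3 := moved_le_supported_of_mem cs hx (sub_mem_moved cs _ (simpleRoot i))
    simpa using add_mem h3 (simpleRoot_mem_supported (show i ∈ {i | i ∈ l} from hi))
  have hv0 := eq_zero_of_coroot_eq_zero cs hmem (coroot_eq_zero_of_wordProd_fixed cs hl hfix')
  have hle : geomRep cs (c⁻¹ ^ 0 * u) (simpleRoot i) ≤ v :=
    Finset.single_le_sum (f := fun n => geomRep cs (c⁻¹ ^ n * u) (simpleRoot i))
      (fun n _ => hpos n) (Finset.mem_range.2 hNpos)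
  rw [hv0] at hle
  exact simpleRoot_ne_zero i (by simpa using le_antisymm hle (hpos 0))

/-- Where the c⁻¹-orbit of the root of t changes sign, one letter of the reversed word for c is
responsible. Up to conjugation by a power of c, multiplying by t deletes that letter from c. -/
theorem exists_reflection_mul_wordProd [Finite W] {l : List B} (hl : l.Nodup) {t : W}
    (ht : t ∈ reflections (simples cs)) (htl : t ∈ Subgroup.closure (cs.simple '' {i | i ∈ l})) :
    ∃ (g : W) (l' : List B), l'.Nodup ∧ t * cs.wordProd l = g * cs.wordProd l' * g⁻¹ := by
  obtain ⟨u, i, hi, hu, rfl, h0⟩ : ∃ u i, i ∈ l ∧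
      u ∈ Subgroup.closure (cs.simple '' {i | i ∈ l}) ∧ t = u * cs.simple i * u⁻¹ ∧
      0 ≤ geomRep cs u (simpleRoot i) := by
    obtain ⟨u, hu, i, hi, rfl⟩ := exists_conj_simple_of_mem_closure cs ht htl
    rcases geomRep_simpleRoot_nonneg_or_nonpos cs u i with h | h
    · exact ⟨u, i, hi, hu, rfl, h⟩
    · refine ⟨u * cs.simple i, i, hi, mul_mem hu (Subgroup.subset_closure ⟨i, hi, rfl⟩),
        (mul_simple_conj cs u i).symm, ?_⟩
      rw [geomRep_mul_simple_simpleRoot]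
      exact neg_nonneg.2 h
  obtain ⟨n, h1, h2⟩ := exists_pow_nonneg_nonpos cs hl hi hu h0
  obtain ⟨ω₁, k, ω₂, h3, h4⟩ := exists_split_of_nonneg_of_nonpos cs l.reverse _ i h1 (by
    rwa [cs.wordProd_reverse, ← mul_assoc, ← pow_succ'])
  have hl' : l = ω₂.reverse ++ k :: ω₁.reverse := by
    rw [← l.reverse_reverse, h3]; simp
  refine ⟨cs.wordProd l ^ n, ω₂.reverse ++ ω₁.reverse, ?_, ?_⟩
  · rw [hl'] at hl
    exact hl.sublist (List.Sublist.append_left (List.sublist_cons_self _ _) _)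
  · have hc : cs.wordProd l = (cs.wordProd ω₂)⁻¹ * (cs.simple k * (cs.wordProd ω₁)⁻¹) := by
      conv_lhs => rw [hl']
      rw [cs.wordProd_append, cs.wordProd_cons, cs.wordProd_reverse, cs.wordProd_reverse]
    have ht : u * cs.simple i * u⁻¹ = cs.wordProd l ^ n *
        ((cs.wordProd ω₂)⁻¹ * cs.simple k * cs.wordProd ω₂) * (cs.wordProd l ^ n)⁻¹ := by
      rw [← h4, inv_pow]
      group
    have hcomm : (cs.wordProd l ^ n)⁻¹ * cs.wordProd l = cs.wordProd l * (cs.wordProd l ^ n)⁻¹ :=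
      ((Commute.refl (cs.wordProd l)).pow_left n).inv_left.eq
    rw [ht, mul_assoc, hcomm, ← mul_assoc, cs.wordProd_append, cs.wordProd_reverse,
      cs.wordProd_reverse, mul_assoc (cs.wordProd l ^ n)]
    congr 2
    rw [hc]
    simp only [mul_assoc, mul_inv_cancel_left, cs.simple_mul_simple_cancel_left]

end Moved

section ParabolicFacts

variable {B : Type*} {M : CoxeterMatrix B} {W : Type*} [Group W] (cs : CoxeterSystem M W)

/-! ### Parabolic subgroups -/

theorem mem_parabolic_iff {w : W} {I : Set B} {y : W} :
    y ∈ parabolic cs w I ↔ w⁻¹ * y * w ∈ Subgroup.closure (cs.simple '' I) := by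
  rw [parabolic, Subgroup.mem_map]
  constructor
  · rintro ⟨z, hz, rfl⟩
    have e : w⁻¹ * (MulAut.conj w).toMonoidHom z * w = z := by simp [mul_assoc]
    rwa [e]
  · exact fun h => ⟨_, h, by simp [mul_assoc]⟩

theorem mem_parabolic_iff_moved_le {w : W} {I : Set B} {y : W} :
    y ∈ parabolic cs w I ↔ moved cs y ≤
      (Finsupp.supported ℝ ℝ I).map (geomRep cs w : (B →₀ ℝ) →ₗ[ℝ] (B →₀ ℝ)) := by
  have e : y = w * (w⁻¹ * y * w) * w⁻¹ := by group
  rw [mem_parabolic_iff, mem_closure_iff_moved_le]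
  conv_rhs => rw [e, moved_conj]
  exact (Submodule.map_le_map_iff_of_injective (geomRep cs w).injective _ _).symm

theorem parabolic_mul_right {w u : W} {I : Set B}
    (hu : u ∈ Subgroup.closure (cs.simple '' I)) : parabolic cs (w * u) I = parabolic cs w I := by
  ext y
  rw [mem_parabolic_iff, mem_parabolic_iff]
  have e : (w * u)⁻¹ * y * (w * u) = u⁻¹ * (w⁻¹ * y * w) * u := by group
  rw [e, Subgroup.mul_mem_cancel_right _ hu, Subgroup.mul_mem_cancel_left _ (inv_mem hu)]

theorem conj_simple_mem_parabolic (w : W) {I : Set B} {i : B} (hi : i ∈ I) :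
    w * cs.simple i * w⁻¹ ∈ parabolic cs w I := by
  rw [mem_parabolic_iff]
  exact Subgroup.subset_closure ⟨i, hi, by group⟩

theorem prod_map_conj_simple (w : W) (l : List B) :
    (l.map fun i => w * cs.simple i * w⁻¹).prod = w * cs.wordProd l * w⁻¹ := by
  induction l with
  | nil => simp
  | cons i l ih => rw [List.map_cons, List.prod_cons, ih, cs.wordProd_cons]; group

theorem exists_list_parabolic (w : W) {I : Set B} {l : List B} (hl : ∀ i ∈ l, i ∈ I) :
    ∃ L : List (parabolic cs w I), (∀ x ∈ L, x ∈ parabolicSimples cs w I) ∧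
      L.map Subtype.val = l.map fun i => w * cs.simple i * w⁻¹ := by
  induction l with
  | nil => exact ⟨[], by simp, rfl⟩
  | cons i l ih =>
    obtain ⟨L, h1, h2⟩ := ih fun j hj => hl j (by simp [hj])
    have hi := hl i (by simp)
    refine ⟨⟨_, conj_simple_mem_parabolic cs w hi⟩ :: L, ?_, by simp [h2]⟩
    simp only [List.mem_cons, forall_eq_or_imp]
    exact ⟨⟨i, hi, rfl⟩, h1⟩

theorem exists_list_of_parabolicSimples (w : W) {I : Set B} {L : List (parabolic cs w I)}
    (hL : ∀ x ∈ L, x ∈ parabolicSimples cs w I) :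
    ∃ l : List B, (∀ i ∈ l, i ∈ I) ∧
      L.map Subtype.val = l.map fun i => w * cs.simple i * w⁻¹ := by
  induction L with
  | nil => exact ⟨[], by simp, rfl⟩
  | cons x L ih =>
    obtain ⟨l, h1, h2⟩ := ih fun y hy => hL y (by simp [hy])
    obtain ⟨i, hi, e⟩ := hL x (by simp)
    refine ⟨i :: l, ?_, by simp [h2, e]⟩
    simp only [List.mem_cons, forall_eq_or_imp]
    exact ⟨hi, h1⟩

theorem coe_list_prod (H : Subgroup W) (L : List H) :
    ((L.prod : H) : W) = (L.map Subtype.val).prod :=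
  map_list_prod H.subtype L

theorem closure_parabolicSimples (w : W) (I : Set B) :
    Submonoid.closure (parabolicSimples cs w I) = ⊤ := by
  rw [eq_top_iff]
  rintro ⟨x, hx⟩ -
  obtain ⟨ω, hω, e⟩ := exists_wordProd_of_mem_closure cs ((mem_parabolic_iff cs).1 hx)
  obtain ⟨L, h1, h2⟩ := exists_list_parabolic cs w hω
  have h3 : (⟨x, hx⟩ : parabolic cs w I) = L.prod := by
    apply Subtype.ext
    rw [coe_list_prod, h2, prod_map_conj_simple, ← e]
    group
  rw [h3]
  exact Submonoid.list_prod_mem _ fun y hy => Submonoid.subset_closure (h1 y hy)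

theorem coe_mem_reflections {w : W} {I : Set B} {x : parabolic cs w I}
    (hx : x ∈ reflections (parabolicSimples cs w I)) : (x : W) ∈ reflections (simples cs) := by
  obtain ⟨s, ⟨i, -, hs⟩, g, rfl⟩ := hx
  refine ⟨cs.simple i, ⟨i, rfl⟩, g * w, ?_⟩
  rw [Subgroup.coe_mul, Subgroup.coe_mul, Subgroup.coe_inv, hs]
  group

theorem mk_mem_reflections {w : W} {I : Set B} {t : W} (ht : t ∈ reflections (simples cs))
    (htP : t ∈ parabolic cs w I) :
    (⟨t, htP⟩ : parabolic cs w I) ∈ reflections (parabolicSimples cs w I) := by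
  have h1 : w⁻¹ * t * w ∈ reflections (simples cs) := by
    obtain ⟨s, hs, g, rfl⟩ := ht
    exact ⟨s, hs, w⁻¹ * g, by group⟩
  obtain ⟨u, hu, i, hi, e⟩ := exists_conj_simple_of_mem_closure cs h1
    ((mem_parabolic_iff cs).1 htP)
  refine ⟨⟨_, conj_simple_mem_parabolic cs w hi⟩, ⟨i, hi, rfl⟩, ⟨w * u * w⁻¹, ?_⟩, ?_⟩
  · rw [mem_parabolic_iff]
    have e : w⁻¹ * (w * u * w⁻¹) * w = u := by group
    rwa [e]
  · apply Subtype.ext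
    have e' : t = w * (w⁻¹ * t * w) * w⁻¹ := by group
    rw [Subgroup.coe_mul, Subgroup.coe_mul, Subgroup.coe_inv]
    change t = _
    rw [e', e]
    group

/-! ### Coxeter elements of parabolic subgroups -/

/-- The element conjugating inside the parabolic is absorbed into w, which leaves the subgroup
unchanged. The intrinsic length bound later feeds `IsCompatible`. -/
theorem exists_eq_conj_wordProd {w : W} {I : Set B} {c : parabolic cs w I}
    (hc : IsCoxeterElement (parabolicSimples cs w I) c) :
    ∃ (g : W) (l : List B), l.Nodup ∧ parabolic cs w I = parabolic cs g {i | i ∈ l} ∧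
      (c : W) = g * cs.wordProd l * g⁻¹ ∧
      absLength (parabolicSimples cs w I) c ≤ l.length := by
  obtain ⟨c₀, ⟨L, hnd, hmem, rfl⟩, hconj⟩ := hc
  obtain ⟨⟨x, hx⟩, rfl⟩ := isConj_iff.1 hconj
  obtain ⟨l, hlI, hl⟩ := exists_list_of_parabolicSimples cs w fun x hx => (hmem x).1 hx
  have hlnd : l.Nodup := by
    apply List.Nodup.of_map (fun i => w * cs.simple i * w⁻¹)
    rw [← hl]
    exact hnd.map Subtype.val_injective
  have hlI' : {i | i ∈ l} = I := by
    ext i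
    refine ⟨hlI i, fun hi => ?_⟩
    have h1 := List.mem_map_of_mem (f := Subtype.val) ((hmem ⟨_, conj_simple_mem_parabolic cs w hi⟩).2 ⟨i, hi, rfl⟩)
    rw [hl, List.mem_map] at h1
    obtain ⟨j, hj, e⟩ := h1
    have e' : cs.simple j = cs.simple i := mul_left_cancel (mul_right_cancel e)
    rwa [← simple_injective cs e']
  have hu := (mem_parabolic_iff cs).1 hx
  refine ⟨w * (w⁻¹ * x * w), l, hlnd, ?_, ?_, ?_⟩
  · rw [hlI', parabolic_mul_right cs hu]
  · rw [Subgroup.coe_mul, Subgroup.coe_mul, Subgroup.coe_inv, coe_list_prod, hl,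
      prod_map_conj_simple]
    group
  · refine (absLength_conj_le (closure_parabolicSimples cs w I) _ _).trans ?_
    have h1 := absLength_le (S := parabolicSimples cs w I) (l := L) fun t ht =>
      ⟨t, (hmem t).1 ht, 1, by simp⟩
    have h2 := congrArg List.length hl
    rw [List.length_map, List.length_map] at h2
    exact h1.trans h2.le

theorem isCoxeterElementIn_conj_wordProd (w : W) {l : List B} (hl : l.Nodup) :
    IsCoxeterElementIn cs (parabolic cs w {i | i ∈ l}) (w * cs.wordProd l * w⁻¹) := by
  obtain ⟨L, h1, h2⟩ := exists_list_parabolic cs w (I := {i | i ∈ l}) (l := l) fun _ h => h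
  have hinj : Function.Injective fun i => w * cs.simple i * w⁻¹ := fun i j h =>
    simple_injective cs (mul_left_cancel (mul_right_cancel h))
  refine ⟨w, _, rfl, L.prod, ⟨L.prod, ⟨L, ?_, fun x => ⟨h1 x, ?_⟩, rfl⟩, IsConj.refl _⟩, ?_⟩
  · apply List.Nodup.of_map Subtype.val
    rw [h2]
    exact hl.map hinj
  · rintro ⟨i, hi, e⟩
    have h3 : (x : W) ∈ L.map Subtype.val := by
      rw [h2, e]
      exact List.mem_map.2 ⟨i, hi, rfl⟩
    exact (List.mem_map_of_injective Subtype.val_injective).1 h3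
  · rw [coe_list_prod, h2, prod_map_conj_simple]

/-! ### Elements below a Coxeter element are parabolic Coxeter elements -/

section FiniteRank

variable [Finite B] [Finite W]

theorem moved_conj_wordProd (w : W) {l : List B} (hl : l.Nodup) :
    moved cs (w * cs.wordProd l * w⁻¹) = (Finsupp.supported ℝ ℝ {i | i ∈ l}).map
      (geomRep cs w : (B →₀ ℝ) →ₗ[ℝ] (B →₀ ℝ)) := by
  rw [moved_conj, moved_wordProd cs hl]

theorem mem_parabolic_iff_moved_le_moved (w : W) {l : List B} (hl : l.Nodup) {y : W} :
    y ∈ parabolic cs w {i | i ∈ l} ↔ moved cs y ≤ moved cs (w * cs.wordProd l * w⁻¹) := by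
  rw [mem_parabolic_iff_moved_le, moved_conj_wordProd cs w hl]

theorem finrank_moved_conj_wordProd (w : W) {l : List B} (hl : l.Nodup) :
    Module.finrank ℝ (moved cs (w * cs.wordProd l * w⁻¹)) = l.length := by
  rw [moved_conj_wordProd cs w hl, ← finrank_supported_list hl]
  exact LinearEquiv.finrank_map_eq (geomRep cs w) _

theorem absLength_conj_wordProd (w : W) {l : List B} (hl : l.Nodup) :
    absLength (simples cs) (w * cs.wordProd l * w⁻¹) = l.length := by
  apply le_antisymm
  · refine (absLength_conj_le cs.submonoid_closure_range_simple _ _).trans ?_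
    have h := absLength_le (S := simples cs) (l := l.map cs.simple) (by
      intro t ht
      obtain ⟨i, -, rfl⟩ := List.mem_map.1 ht
      exact ⟨cs.simple i, ⟨i, rfl⟩, 1, by simp⟩)
    rwa [List.length_map] at h
  · rw [← finrank_moved_conj_wordProd cs w hl]
    exact finrank_moved_le_absLength cs _

theorem mem_parabolic_of_absLE (w : W) {l : List B} (hl : l.Nodup) {x : W}
    (h : AbsLE (simples cs) x (w * cs.wordProd l * w⁻¹)) : x ∈ parabolic cs w {i | i ∈ l} := by
  rw [mem_parabolic_iff_moved_le_moved cs w hl]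
  apply moved_le_of_absLE cs h
  rw [finrank_moved_conj_wordProd cs w hl, absLength_conj_wordProd cs w hl]

/-- Induction on ℓ_T(x⁻¹c). The first reflection t of a minimal word for cx⁻¹ lies below c, hence in
its parabolic. Then tc is again a Coxeter element of a parabolic, with x below it and one step
closer. -/
theorem exists_eq_conj_wordProd_of_absLE (n : ℕ) {x : W} (w : W) {l : List B} (hl : l.Nodup)
    (h : AbsLE (simples cs) x (w * cs.wordProd l * w⁻¹))
    (hn : absLength (simples cs) (x⁻¹ * (w * cs.wordProd l * w⁻¹)) = n) :
    ∃ (g : W) (l' : List B), l'.Nodup ∧ x = g * cs.wordProd l' * g⁻¹ := by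
  have hS : Submonoid.closure (simples cs) = ⊤ := cs.submonoid_closure_range_simple
  induction n generalizing w l with
  | zero =>
    obtain ⟨m, -, h2, h3⟩ := exists_min_word hS (x⁻¹ * (w * cs.wordProd l * w⁻¹))
    rw [hn, List.length_eq_zero_iff] at h3
    rw [h3, List.prod_nil] at h2
    exact ⟨w, l, hl, (inv_mul_eq_one.1 h2.symm)⟩
  | succ n ih =>
    set c := w * cs.wordProd l * w⁻¹ with hc
    -- This element is cx⁻¹, so its first letter can be removed from the left of c.
    obtain ⟨m, h1, h2, h3⟩ := exists_min_word hS (x * (x⁻¹ * c) * x⁻¹)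
    have h4 := absLength_conj_le hS x⁻¹ (x * (x⁻¹ * c) * x⁻¹)
    have h4' := absLength_conj_le hS x (x⁻¹ * c)
    have e : x⁻¹ * (x * (x⁻¹ * c) * x⁻¹) * x⁻¹⁻¹ = x⁻¹ * c := by group
    rw [e] at h4
    obtain ⟨t, m, rfl⟩ : ∃ t m', m = t :: m' := by
      cases m with
      | nil => rw [List.length_nil] at h3; omega
      | cons t m => exact ⟨t, m, rfl⟩
    have ht := h1 t (by simp)
    have hm := absLength_le (S := simples cs) (l := m) fun s hs => h1 s (by simp [hs])
    have ht1 := absLength_le (S := simples cs) (l := [t]) (by simpa using ht)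
    rw [List.length_cons] at h3
    rw [List.prod_cons] at h2
    simp only [List.prod_cons, List.prod_nil, mul_one, List.length_cons, List.length_nil] at ht1
    have htc : t⁻¹ * c = m.prod * x := by
      have : c = t * m.prod * x := by rw [h2]; group
      rw [this]; group
    have h5 := absLength_mul_le hS m.prod x
    rw [← htc] at h5
    have h6 := absLength_mul_le hS t (t⁻¹ * c)
    rw [mul_inv_cancel_left] at h6
    have hA : absLength (simples cs) c =
      absLength (simples cs) x + absLength (simples cs) (x⁻¹ * c) := h
    have htle : AbsLE (simples cs) t c := by
      unfold AbsLE
      omega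
    have htP := mem_parabolic_of_absLE cs w hl htle
    have htinv : t⁻¹ = t := by
      obtain ⟨_, ⟨i, rfl⟩, g, rfl⟩ := ht
      simp [mul_assoc]
    have ht' : w⁻¹ * t * w ∈ reflections (simples cs) := by
      obtain ⟨s, hs, g, rfl⟩ := ht
      exact ⟨s, hs, w⁻¹ * g, by group⟩
    obtain ⟨g, l', hl', e'⟩ := exists_reflection_mul_wordProd cs hl ht'
      ((mem_parabolic_iff cs).1 htP)
    have htc' : t⁻¹ * c = (w * g) * cs.wordProd l' * (w * g)⁻¹ := by
      have : t * c = w * (w⁻¹ * t * w * cs.wordProd l) * w⁻¹ := by rw [hc]; group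
      rw [htinv, this, e']
      group
    have hxe : absLength (simples cs) (x⁻¹ * (t⁻¹ * c)) ≤ m.length := by
      have := absLength_conj_le hS x⁻¹ m.prod
      rw [inv_inv, mul_assoc, ← htc] at this
      exact this.trans hm
    have h7 := absLength_mul_le hS x (x⁻¹ * (t⁻¹ * c))
    rw [mul_inv_cancel_left] at h7
    refine ih (w * g) hl' ?_ ?_
    · rw [← htc']
      unfold AbsLE
      omega
    · rw [← htc']
      omega

theorem existsUnique_isCoxeterElementIn {c : W} (hc : IsCoxeterElement (simples cs) c) {x : W}
    (hx : AbsLE (simples cs) x c) : ∃! P : Subgroup W, IsCoxeterElementIn cs P x := by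
  obtain ⟨c₀, ⟨L, hnd, hmem, rfl⟩, hconj⟩ := hc
  obtain ⟨w, rfl⟩ := isConj_iff.1 hconj
  obtain ⟨l, rfl⟩ : ∃ l : List B, l.map cs.simple = L := by
    have h : L ∈ Set.range (List.map cs.simple) := by
      rw [Set.range_list_map]
      exact fun x hx => (hmem x).1 hx
    exact h
  obtain ⟨g, l', hl', rfl⟩ := exists_eq_conj_wordProd_of_absLE cs _ w hnd.of_map hx rfl
  refine ⟨_, isCoxeterElementIn_conj_wordProd cs g hl', ?_⟩
  rintro P ⟨w', I, rfl, x', hx', e⟩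
  obtain ⟨g', l'', hl'', hP, e', -⟩ := exists_eq_conj_wordProd cs hx'
  rw [hP]
  ext y
  rw [mem_parabolic_iff_moved_le_moved cs _ hl'', mem_parabolic_iff_moved_le_moved cs _ hl',
    ← e', e]

end FiniteRank

end ParabolicFacts

/-! ### Geodesic sequences for the absolute length -/

section Formal

variable {G : Type*} [Group G] {S : Set G}

theorem absLength_conj (hS : Submonoid.closure S = ⊤) (g a : G) :
    absLength S (g * a * g⁻¹) = absLength S a := by
  apply le_antisymm (absLength_conj_le hS g a)
  have h := absLength_conj_le hS g⁻¹ (g * a * g⁻¹)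
  have e : g⁻¹ * (g * a * g⁻¹) * g⁻¹⁻¹ = a := by group
  rwa [e] at h

theorem AbsLE.trans (hS : Submonoid.closure S = ⊤) {x y z : G} (h1 : AbsLE S x y)
    (h2 : AbsLE S y z) : AbsLE S x z := by
  have h3 := absLength_mul_le hS x (x⁻¹ * z)
  have h4 := absLength_mul_le hS (x⁻¹ * y) (y⁻¹ * z)
  rw [mul_inv_cancel_left] at h3
  rw [mul_assoc, mul_inv_cancel_left] at h4
  unfold AbsLE at *
  omega

theorem absLE_of_le (hS : Submonoid.closure S = ⊤) {p : ℕ → G} (hp : ∀ i, AbsLE S (p i) (p (i + 1)))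
    {i j : ℕ} (hij : i ≤ j) : AbsLE S (p i) (p j) := by
  induction j, hij using Nat.le_induction with
  | base => exact absLE_refl S _
  | succ j _ ih => exact ih.trans hS (hp j)

/-- Subadditivity bounds the length of the endpoint by the sum, so attaining the bound leaves no
slack at any step. -/
theorem absLE_of_sum_le (hS : Submonoid.closure S = ⊤) {p : ℕ → G} {N : ℕ}
    (h : absLength S (p 0) + ∑ i ∈ Finset.range N, absLength S ((p i)⁻¹ * p (i + 1)) ≤
      absLength S (p N)) : ∀ i < N, AbsLE S (p i) (p (i + 1)) := by
  have hle : ∀ n, absLength S (p n) ≤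
      absLength S (p 0) + ∑ i ∈ Finset.range n, absLength S ((p i)⁻¹ * p (i + 1)) := by
    intro n
    induction n with
    | zero => simp
    | succ n ih =>
      have h1 := absLength_mul_le hS (p n) ((p n)⁻¹ * p (n + 1))
      rw [mul_inv_cancel_left] at h1
      rw [Finset.sum_range_succ]
      omega
  induction N with
  | zero => simp
  | succ N ih =>
    have h1 := absLength_mul_le hS (p N) ((p N)⁻¹ * p (N + 1))
    rw [mul_inv_cancel_left] at h1
    rw [Finset.sum_range_succ] at h
    have h2 := hle N
    intro i hi
    rcases Nat.lt_succ_iff_lt_or_eq.1 hi with hi | rfl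
    · exact ih (by omega) i hi
    · unfold AbsLE
      omega

theorem absLength_eq_sum {p : ℕ → G} (hp : ∀ i, AbsLE S (p i) (p (i + 1))) (n : ℕ) :
    absLength S (p n) =
      absLength S (p 0) + ∑ i ∈ Finset.range n, absLength S ((p i)⁻¹ * p (i + 1)) := by
  induction n with
  | zero => simp
  | succ n ih => rw [Finset.sum_range_succ, ← add_assoc, ← ih]; exact hp n

theorem absLength_twist (hS : Submonoid.closure S = ⊤) (a b p m m' : G) :
    absLength S ((m * a⁻¹ * p)⁻¹ * (m' * b⁻¹ * p)) =
      absLength S ((a⁻¹ * b)⁻¹ * (m⁻¹ * m')) := by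
  rw [← absLength_conj hS (p⁻¹ * b) ((a⁻¹ * b)⁻¹ * (m⁻¹ * m'))]
  congr 1
  group

/-- Twisting lowers both lengths by ℓ_T(a⁻¹b) and replaces the quotient by a conjugate, so the
length equation is unaffected. -/
theorem absLE_twist_iff (hS : Submonoid.closure S = ⊤) {a b p m m' n n' : G}
    (hm : AbsLE S (a⁻¹ * b) (m⁻¹ * m')) (hn : AbsLE S (a⁻¹ * b) (n⁻¹ * n')) :
    AbsLE S ((m * a⁻¹ * p)⁻¹ * (m' * b⁻¹ * p)) ((n * a⁻¹ * p)⁻¹ * (n' * b⁻¹ * p)) ↔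
      AbsLE S (m⁻¹ * m') (n⁻¹ * n') := by
  have e : absLength S (((m * a⁻¹ * p)⁻¹ * (m' * b⁻¹ * p))⁻¹ *
      ((n * a⁻¹ * p)⁻¹ * (n' * b⁻¹ * p))) = absLength S ((m⁻¹ * m')⁻¹ * (n⁻¹ * n')) := by
    rw [← absLength_conj hS (p⁻¹ * b) ((m⁻¹ * m')⁻¹ * (n⁻¹ * n'))]
    congr 1
    group
  unfold AbsLE at hm hn ⊢
  rw [e, absLength_twist hS, absLength_twist hS]
  omega

theorem absLE_twist (hS : Submonoid.closure S = ⊤) {c : G} {P M : ℕ → G} {N : ℕ}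
    (hP : ∀ i, AbsLE S (P i) (P (i + 1))) (hM : ∀ i, AbsLE S (M i) (M (i + 1)))
    (hPN : ∀ r, N ≤ r → P r = c) (hMN : ∀ r, N ≤ r → M r = c)
    (hPM : ∀ i, AbsLE S ((P i)⁻¹ * P (i + 1)) ((M i)⁻¹ * M (i + 1))) (i : ℕ) :
    AbsLE S (M i * (P i)⁻¹ * P 0) (M (i + 1) * (P (i + 1))⁻¹ * P 0) := by
  rcases Nat.lt_or_ge i N with hi | hi
  · refine absLE_of_sum_le hS (p := fun i => M i * (P i)⁻¹ * P 0) (N := N) ?_ i hi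
    have h1 := absLength_eq_sum hP N
    have h2 := absLength_eq_sum hM N
    rw [hPN N le_rfl] at h1
    rw [hMN N le_rfl] at h2
    have h3 : ∑ i ∈ Finset.range N, absLength S ((M i)⁻¹ * M (i + 1)) =
        ∑ i ∈ Finset.range N, absLength S ((P i)⁻¹ * P (i + 1)) +
        ∑ i ∈ Finset.range N, absLength S
          ((M i * (P i)⁻¹ * P 0)⁻¹ * (M (i + 1) * (P (i + 1))⁻¹ * P 0)) := by
      rw [← Finset.sum_add_distrib]
      refine Finset.sum_congr rfl fun j _ => ?_
      rw [absLength_twist hS]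
      exact hPM j
    -- The twisted chain starts at `M 0` and ends at `P 0`. Subtracting the length sums of P and M,
    -- which both end at c, shows that it is geodesic.
    simp only [inv_mul_cancel_right, hPN N le_rfl, hMN N le_rfl, mul_inv_cancel, one_mul]
    omega
  · simp only [hPN i hi, hMN i hi, hPN (i + 1) (by omega), hMN (i + 1) (by omega)]
    exact absLE_refl S _

theorem absLE_of_absLE_twist (hS : Submonoid.closure S = ⊤) {c : G} {P M : ℕ → G} {N : ℕ}
    (hP : ∀ i, AbsLE S (P i) (P (i + 1)))
    (hPN : ∀ r, N ≤ r → P r = c) (hMN : ∀ r, N ≤ r → M r = c)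
    (hQ : ∀ i, AbsLE S (M i * (P i)⁻¹ * P 0) (M (i + 1) * (P (i + 1))⁻¹ * P 0)) (i : ℕ) :
    AbsLE S (M i) (M (i + 1)) ∧ AbsLE S ((P i)⁻¹ * P (i + 1)) ((M i)⁻¹ * M (i + 1)) := by
  rcases Nat.lt_or_ge i N with hi | hi
  · have h1 := absLength_eq_sum hP N
    have h2 := absLength_eq_sum (p := fun i => M i * (P i)⁻¹ * P 0) hQ N
    simp only [inv_mul_cancel_right, hPN N le_rfl, hMN N le_rfl, mul_inv_cancel, one_mul,
      absLength_twist hS] at h1 h2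
    have hle : ∀ j, absLength S ((M j)⁻¹ * M (j + 1)) ≤ absLength S ((P j)⁻¹ * P (j + 1)) +
        absLength S (((P j)⁻¹ * P (j + 1))⁻¹ * ((M j)⁻¹ * M (j + 1))) := by
      intro j
      have h := absLength_mul_le hS ((P j)⁻¹ * P (j + 1))
        (((P j)⁻¹ * P (j + 1))⁻¹ * ((M j)⁻¹ * M (j + 1)))
      rwa [mul_inv_cancel_left] at h
    have h3 := Finset.sum_le_sum (s := Finset.range N) fun j _ => hle j
    have h4 : absLength S c ≤ absLength S (M 0) +
        ∑ j ∈ Finset.range N, absLength S ((M j)⁻¹ * M (j + 1)) := by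
      clear h2 h3
      rw [← hMN N le_rfl]
      clear h1 hPN hMN hi
      induction N with
      | zero => simp
      | succ n ih =>
        have h1 := absLength_mul_le hS (M n) ((M n)⁻¹ * M (n + 1))
        rw [mul_inv_cancel_left] at h1
        rw [Finset.sum_range_succ]
        omega
    rw [Finset.sum_add_distrib] at h3
    constructor
    · refine absLE_of_sum_le hS (N := N) ?_ i hi
      rw [hMN N le_rfl]
      omega
    · refine (Finset.sum_eq_sum_iff_of_le (s := Finset.range N) fun j _ => hle j).1 ?_ i
        (Finset.mem_range.2 hi)
      rw [Finset.sum_add_distrib]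
      omega
  · rw [hPN i hi, hMN i hi, hPN (i + 1) (by omega), hMN (i + 1) (by omega)]
    exact ⟨absLE_refl S _, absLE_refl S _⟩

/-! ### Multichains and delta sequences as sequences indexed by `ℕ` -/

variable {k : ℕ∞} {c : G}

theorem extend_of_not_lt {A : Type*} {a : A} {x : Idx k → A} {i : ℕ} (h : ¬ (i : ℕ∞) < k) :
    extend a x i = a := by
  simp only [extend, dif_neg h]

theorem extend_coe {A : Type*} {a : A} {x : Idx k → A} (i : Idx k) : extend a x i.1 = x i := by
  simp only [extend, dif_pos i.2]

theorem extend_ext {A : Type*} {a : A} {x y : Idx k → A}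
    (h : ∀ i, extend a x i = extend a y i) : x = y := by
  funext i
  have := h i.1
  rwa [extend_coe, extend_coe] at this

theorem exists_multichain (hS : Submonoid.closure S = ⊤) {p : ℕ → G}
    (hp : ∀ i, AbsLE S (p i) (p (i + 1))) {N : ℕ} (hN : ∀ r, N ≤ r → p r = c)
    (hk : ∀ i : ℕ, ¬ (i : ℕ∞) < k → p i = c) :
    ∃ μ : Multichain k S c, ∀ i, extend c μ.entry i = p i := by
  have hext : ∀ i, extend c (fun i : Idx k => p i.1) i = p i := by
    intro i
    by_cases h : (i : ℕ∞) < k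
    · simp only [extend, dif_pos h]
    · rw [extend_of_not_lt h, hk i h]
  refine ⟨⟨fun i => p i.1, fun i => ⟨absLE_one S _, ?_⟩, fun i j hij => absLE_of_le hS hp hij,
    N, fun r hr => ?_⟩, hext⟩
  · rw [← hN (max i.1 N) (le_max_right _ _)]
    exact absLE_of_le hS hp (le_max_left _ _)
  · rw [hext, hN r hr]

theorem Multichain.le_iff {π μ : Multichain k S c} :
    π ≤ μ ↔ ∀ i : ℕ, AbsLE S ((extend c μ.entry i)⁻¹ * extend c μ.entry (i + 1))
      ((extend c π.entry i)⁻¹ * extend c π.entry (i + 1)) := by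
  simp only [← extend_diff]
  constructor
  · intro h i
    by_cases hi : (i : ℕ∞) < k
    · simp only [extend, dif_pos hi]
      exact h _
    · rw [extend_of_not_lt hi, extend_of_not_lt hi]
      exact absLE_refl S 1
  · intro h i
    have := h i.1
    rwa [extend_coe, extend_coe] at this

/-- The inverse takes partial products δ₀δ₁⋯δ_i, which form a chain because the lengths add up. The
product condition makes δ₀ recoverable from the other entries. -/
theorem delta_bijective (hS : Submonoid.closure S = ⊤) :
    Function.Bijective (Multichain.delta hS : Multichain k S c → DeltaSeq k S c) := by
  constructor
  · intro π μ h
    have hd : π.diff = μ.diff := congrArg DeltaSeq.entry h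
    obtain ⟨N, hN⟩ := π.eventually
    obtain ⟨N', hN'⟩ := μ.eventually
    have h0 : extend c π.entry 0 = extend c μ.entry 0 := by
      have h1 := diff_prod π (max N N')
      have h2 := diff_prod μ (max N N')
      rw [hN _ (le_max_left _ _)] at h1
      rw [hN' _ (le_max_right _ _), ← hd] at h2
      exact mul_right_cancel (h1.trans h2.symm)
    refine Multichain.ext (extend_ext (a := c) fun n => ?_)
    rw [← diff_prod π n, ← diff_prod μ n, hd, h0]
  · rintro ⟨δ, δ₀, -, -, N, hN, hprod, hsum⟩
    set p : ℕ → G := fun i => δ₀ * ((List.range i).map (extend 1 δ)).prod with hp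
    have hstep : ∀ i, p (i + 1) = p i * extend 1 δ i := by
      intro i
      simp only [hp, List.range_succ, List.map_append, List.prod_append, List.map_singleton,
        List.prod_singleton, mul_assoc]
    have hdiff : ∀ i, (p i)⁻¹ * p (i + 1) = extend 1 δ i := by
      intro i
      rw [hstep, inv_mul_cancel_left]
    have hconst : ∀ r, (∀ j, r ≤ j → extend 1 δ j = 1) → ∀ j, r ≤ j → p j = p r := by
      intro r h j hj
      induction j, hj using Nat.le_induction with
      | base => rfl
      | succ j hj ih => rw [hstep, h j hj, mul_one, ih]
    have hpN : ∀ r, N ≤ r → p r = c := fun r hr => (hconst N hN r hr).trans hprod.symm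
    have hchain : ∀ i, AbsLE S (p i) (p (i + 1)) := by
      intro i
      rcases Nat.lt_or_ge i N with hi | hi
      · refine absLE_of_sum_le hS ?_ i hi
        rw [hpN N le_rfl, hsum, Finset.sum_congr rfl fun j _ => by rw [hdiff j]]
        simp [hp]
      · rw [hpN i hi, hpN (i + 1) (by omega)]
        exact absLE_refl S c
    obtain ⟨μ, hμ⟩ := exists_multichain (k := k) hS hchain hpN (by
      intro i hi
      -- Past a finite k every entry is the default 1, so the partial products have already reached
      -- c.
      rw [← hpN (max i N) (le_max_right _ _)]
      refine (hconst i (fun j hj => extend_of_not_lt fun h => hi ?_) _ (le_max_left _ _)).symm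
      exact lt_of_le_of_lt (by exact_mod_cast hj) h)
    refine ⟨μ, DeltaSeq.ext (extend_ext (a := 1) fun i => ?_)⟩
    change extend 1 μ.diff i = _
    rw [extend_diff, hμ, hμ, hdiff]

end Formal

/-! ### The interval below a Coxeter element of a subgroup -/

section Sub

variable {G : Type*} [Group G] {S : Set G} {H : Subgroup G} {S' : Set H}

theorem absLength_coe_le (hS' : Submonoid.closure S' = ⊤)
    (h1 : ∀ x ∈ reflections S', (x : G) ∈ reflections S) (x : H) :
    absLength S (x : G) ≤ absLength S' x := by
  obtain ⟨l, hl, rfl, hlen⟩ := exists_min_word hS' x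
  have h := absLength_le (S := S) (l := l.map H.subtype) (by
    intro t ht
    obtain ⟨u, hu, rfl⟩ := List.mem_map.1 ht
    exact h1 u (hl u hu))
  rw [← map_list_prod, List.length_map, hlen] at h
  exact h

/-- Every letter of a minimal word for an element below c is itself below c, so the whole word can
be read in H. -/
theorem exists_mem_absLength_le (hS : Submonoid.closure S = ⊤) (hS' : Submonoid.closure S' = ⊤)
    {c : G} (h3 : ∀ t ∈ reflections S, AbsLE S t c → ∃ h : t ∈ H, (⟨t, h⟩ : H) ∈ reflections S')
    (l : List G) (hl : ∀ t ∈ l, t ∈ reflections S) (hlen : l.length = absLength S l.prod)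
    (hc : AbsLE S l.prod c) : ∃ h : l.prod ∈ H, absLength S' ⟨l.prod, h⟩ ≤ l.length := by
  induction l with
  | nil =>
    refine ⟨one_mem H, ?_⟩
    exact (absLength_one S').le
  | cons t l ih =>
    have ht := hl t (by simp)
    have hl' : ∀ s ∈ l, s ∈ reflections S := fun s hs => hl s (by simp [hs])
    have k1 := absLength_le (S := S) (l := [t]) (by simpa using ht)
    have k2 := absLength_le hl'
    have k3 := absLength_mul_le hS t l.prod
    simp only [List.prod_cons, List.prod_nil, mul_one, List.length_cons,
      List.length_nil] at k1 hlen hc ⊢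
    have hle : AbsLE S t (t * l.prod) := by
      unfold AbsLE
      rw [inv_mul_cancel_left]
      omega
    obtain ⟨htH, htr⟩ := h3 t ht (hle.trans hS hc)
    have hlc : AbsLE S l.prod c := by
      have := (inv_mul_mem_NC hS hle hc).2
      rwa [inv_mul_cancel_left] at this
    obtain ⟨hlH, hlr⟩ := ih hl' (by omega) hlc
    refine ⟨mul_mem htH hlH, ?_⟩
    have k4 := absLength_le (S := S') (l := [⟨t, htH⟩]) (by simpa using htr)
    have k5 := absLength_mul_le hS' ⟨t, htH⟩ ⟨l.prod, hlH⟩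
    simp only [List.prod_cons, List.prod_nil, mul_one, List.length_cons, List.length_nil] at k4
    exact k5.trans (by omega)

theorem exists_mem_absLength_eq (hS : Submonoid.closure S = ⊤) (hS' : Submonoid.closure S' = ⊤)
    (h1 : ∀ x ∈ reflections S', (x : G) ∈ reflections S)
    {c : G} (h3 : ∀ t ∈ reflections S, AbsLE S t c → ∃ h : t ∈ H, (⟨t, h⟩ : H) ∈ reflections S')
    {x : G} (hx : AbsLE S x c) : ∃ h : x ∈ H, absLength S' ⟨x, h⟩ = absLength S x := by
  obtain ⟨l, hl, rfl, hlen⟩ := exists_min_word hS x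
  obtain ⟨h, hle⟩ := exists_mem_absLength_le hS hS' h3 l hl hlen hx
  exact ⟨h, le_antisymm (hlen ▸ hle) (absLength_coe_le hS' h1 ⟨l.prod, h⟩)⟩

/-- The hypotheses needed to compare the interval below `c` in `H` with that in `G`. -/
structure IsCompatible (S : Set G) (S' : Set H) (c : H) : Prop where
  closure_eq_top : Submonoid.closure S = ⊤
  closure_eq_top' : Submonoid.closure S' = ⊤
  coe_mem : ∀ x ∈ reflections S', (x : G) ∈ reflections S
  absLength_le : absLength S' c ≤ absLength S (c : G)
  exists_mem : ∀ t ∈ reflections S, AbsLE S t (c : G) →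
    ∃ h : t ∈ H, (⟨t, h⟩ : H) ∈ reflections S'

variable {c : H}

theorem IsCompatible.mem (hH : IsCompatible S S' c) {x : G}
    (hx : AbsLE S x (c : G)) : x ∈ H :=
  (exists_mem_absLength_eq hH.closure_eq_top hH.closure_eq_top' hH.coe_mem hH.exists_mem hx).1

theorem IsCompatible.absLength_eq (hH : IsCompatible S S' c) {x : H} (hx : AbsLE S (x : G) (c : G)) :
    absLength S' x = absLength S (x : G) :=
  (exists_mem_absLength_eq hH.closure_eq_top hH.closure_eq_top' hH.coe_mem hH.exists_mem hx).2

/-- Lengths can only drop on passing from H to G. That of c does not, so neither do those of x and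
x⁻¹c. -/
theorem IsCompatible.coe_absLE (hH : IsCompatible S S' c) {x : H} (hx : AbsLE S' x c) : AbsLE S (x : G) (c : G) := by
  have h1 := absLength_coe_le hH.closure_eq_top' hH.coe_mem x
  have h2 := absLength_coe_le hH.closure_eq_top' hH.coe_mem (x⁻¹ * c)
  have h3 := hH.absLength_le
  have h4 := absLength_mul_le hH.closure_eq_top (x : G) ((x : G)⁻¹ * c)
  rw [mul_inv_cancel_left] at h4
  rw [Subgroup.coe_mul, Subgroup.coe_inv] at h2
  have h5 := absLength_coe_le hH.closure_eq_top' hH.coe_mem c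
  unfold AbsLE at *
  omega

theorem IsCompatible.absLE_iff (hH : IsCompatible S S' c) {x y : H} (hy : AbsLE S (y : G) (c : G)) :
    AbsLE S' x y ↔ AbsLE S (x : G) (y : G) := by
  constructor
  · intro h
    have h1 := absLength_coe_le hH.closure_eq_top' hH.coe_mem x
    have h2 := absLength_coe_le hH.closure_eq_top' hH.coe_mem (x⁻¹ * y)
    have h3 := hH.absLength_eq hy
    have h4 := absLength_mul_le hH.closure_eq_top (x : G) ((x : G)⁻¹ * y)
    rw [mul_inv_cancel_left] at h4
    rw [Subgroup.coe_mul, Subgroup.coe_inv] at h2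
    unfold AbsLE at *
    omega
  · intro h
    have h1 := hH.absLength_eq (h.trans hH.closure_eq_top hy)
    have h2 := hH.absLength_eq (x := x⁻¹ * y) (inv_mul_mem_NC hH.closure_eq_top h hy).2
    have h3 := hH.absLength_eq hy
    unfold AbsLE at *
    rw [h1, h2, h3]
    exact h

end Sub

/-! ### The two poset isomorphisms -/

section Isomorphisms

variable {G : Type*} [Group G] {S : Set G} {H : Subgroup G} {S' : Set H} {c₀ : H} {c : G} {k : ℕ∞}

theorem extend_zero {A : Type*} {a : A} (hk : 1 ≤ k) (x : Idx k → A) :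
    extend a x 0 = x (Idx.first hk) :=
  extend_coe (Idx.first hk)

theorem exists_multichain_of_le (hH : IsCompatible S S' c₀) {π : Multichain k S c}
    (h0 : (c₀ : G) = extend c π.entry 0) {μ : Multichain k S c} (hμ : μ ≤ π) :
    ∃ ν : Multichain k S' c₀, ∀ i, ((extend c₀ ν.entry i : H) : G) =
      extend c μ.entry i * (extend c π.entry i)⁻¹ * extend c π.entry 0 := by
  have hS := hH.closure_eq_top
  obtain ⟨N, hN⟩ := π.eventually
  obtain ⟨N', hN'⟩ := μ.eventually
  have hchain := absLE_twist hS (N := max N N') (extend_entry_succ π) (extend_entry_succ μ)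
    (fun r hr => hN r (le_trans (le_max_left _ _) hr))
    (fun r hr => hN' r (le_trans (le_max_right _ _) hr)) (Multichain.le_iff.1 hμ)
  set q : ℕ → G := fun i =>
    extend c μ.entry i * (extend c π.entry i)⁻¹ * extend c π.entry 0 with hq
  have hstable : ∀ r, extend c π.entry r = c → extend c μ.entry r = c → q r = c₀ := by
    intro r h1 h2
    simp only [hq]
    rw [h1, h2, mul_inv_cancel, one_mul, h0]
  have hqN : ∀ r, max N N' ≤ r → q r = c₀ := fun r hr =>
    hstable r (hN r (le_trans (le_max_left _ _) hr)) (hN' r (le_trans (le_max_right _ _) hr))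
  have hqc : ∀ i, AbsLE S (q i) c₀ := by
    intro i
    rw [← hqN (max i (max N N')) (le_max_right _ _)]
    exact absLE_of_le hS (p := q) hchain (le_max_left _ _)
  obtain ⟨ν, hν⟩ := exists_multichain (S := S') (k := k) (c := c₀) hH.closure_eq_top'
    (p := fun i => ⟨q i, hH.mem (hqc i)⟩)
    (fun i => (hH.absLE_iff (hqc (i + 1))).2 (hchain i))
    (fun r hr => Subtype.ext (hqN r hr))
    (fun i hi => Subtype.ext (hstable i (extend_of_not_lt hi) (extend_of_not_lt hi)))
  exact ⟨ν, fun i => by rw [hν]⟩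

/-- Solving the formula for μ gives μ_i = ν_i π₁⁻¹ π_i. Both the chain property and μ ≤ π come from
`absLE_of_absLE_twist`. -/
theorem exists_le_of_multichain (hH : IsCompatible S S' c₀) {π : Multichain k S c}
    (h0 : (c₀ : G) = extend c π.entry 0) (ν : Multichain k S' c₀) :
    ∃ μ : Multichain k S c, μ ≤ π ∧ ∀ i, ((extend c₀ ν.entry i : H) : G) =
      extend c μ.entry i * (extend c π.entry i)⁻¹ * extend c π.entry 0 := by
  have hS := hH.closure_eq_top
  obtain ⟨N, hN⟩ := π.eventually
  obtain ⟨N', hN'⟩ := ν.eventually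
  set m : ℕ → G := fun i =>
    ((extend c₀ ν.entry i : H) : G) * (extend c π.entry 0)⁻¹ * extend c π.entry i with hm
  have hq : ∀ i, ((extend c₀ ν.entry i : H) : G) =
      m i * (extend c π.entry i)⁻¹ * extend c π.entry 0 := by
    intro i
    simp only [hm]
    group
  have hstable : ∀ r, extend c π.entry r = c → extend c₀ ν.entry r = c₀ → m r = c := by
    intro r h1 h2
    simp only [hm]
    rw [h1, h2, h0, mul_inv_cancel, one_mul]
  have hmN : ∀ r, max N N' ≤ r → m r = c := fun r hr =>
    hstable r (hN r (le_trans (le_max_left _ _) hr)) (hN' r (le_trans (le_max_right _ _) hr))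
  have hchain := absLE_of_absLE_twist hS (N := max N N') (M := m) (extend_entry_succ π)
    (fun r hr => hN r (le_trans (le_max_left _ _) hr)) hmN (fun i => by
      rw [← hq, ← hq]
      exact (hH.absLE_iff (hH.coe_absLE (extend_entry_absLE ν _))).1 (extend_entry_succ ν i))
  obtain ⟨μ, hμ⟩ := exists_multichain (k := k) hS (fun i => (hchain i).1) hmN
    (fun i hi => hstable i (extend_of_not_lt hi) (extend_of_not_lt hi))
  refine ⟨μ, Multichain.le_iff.2 fun i => ?_, fun i => ?_⟩
  · rw [hμ, hμ]
    exact (hchain i).2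
  · rw [hμ, hq]

theorem exists_multichain_orderIso (hH : IsCompatible S S' c₀) {π : Multichain k S c}
    (h0 : (c₀ : G) = extend c π.entry 0) :
    ∃ e : {μ : Multichain k S c // μ ≤ π} ≃o Multichain k S' c₀,
      ∀ μ i, ((extend c₀ (e μ).entry i : H) : G) =
        extend c μ.1.entry i * (extend c π.entry i)⁻¹ * extend c π.entry 0 := by
  choose f hf using fun μ : {μ : Multichain k S c // μ ≤ π} => exists_multichain_of_le hH h0 μ.2
  have hbij : Function.Bijective f := by
    constructor
    · intro μ μ' h
      refine Subtype.ext (Multichain.ext (extend_ext (a := c) fun i => ?_))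
      have h1 := hf μ i
      rw [h, hf μ' i] at h1
      exact (mul_right_cancel (mul_right_cancel h1)).symm
    · intro ν
      obtain ⟨μ, hμ, h⟩ := exists_le_of_multichain hH h0 ν
      refine ⟨⟨μ, hμ⟩, Multichain.ext (extend_ext (a := c₀) fun i => Subtype.ext ?_)⟩
      rw [hf, h]
  refine ⟨⟨Equiv.ofBijective f hbij, ?_⟩, hf⟩
  intro μ μ'
  change f μ ≤ f μ' ↔ μ.1 ≤ μ'.1
  rw [Multichain.le_iff, Multichain.le_iff]
  refine forall_congr' fun i => ?_
  rw [← absLE_twist_iff hH.closure_eq_top (p := extend c π.entry 0)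
    (Multichain.le_iff.1 μ'.2 i) (Multichain.le_iff.1 μ.2 i), ← hf, ← hf, ← hf, ← hf]
  exact hH.absLE_iff (hH.coe_absLE
    (inv_mul_mem_NC hH.closure_eq_top' (extend_entry_succ _ _) (extend_entry_absLE _ _)).2)

theorem exists_deltaSeq_orderIso (hH : IsCompatible S S' c₀) {π : Multichain k S c}
    (h0 : (c₀ : G) = extend c π.entry 0) :
    ∃ e : {ε : DeltaSeq k S c // π.delta hH.closure_eq_top ≤ ε} ≃o DeltaSeq k S' c₀,
      ∀ ε i, ((e ε).entry i : G) =
        (extend c π.entry 0)⁻¹ * π.entry i * ε.1.entry i *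
          (extend c π.entry (i.1 + 1))⁻¹ * extend c π.entry 0 := by
  obtain ⟨e, he⟩ := exists_multichain_orderIso hH h0
  let d := Equiv.ofBijective _ (delta_bijective (S := S) (k := k) (c := c) hH.closure_eq_top)
  let d' := Equiv.ofBijective _ (delta_bijective (S := S') (k := k) (c := c₀) hH.closure_eq_top')
  let r : {μ : Multichain k S c // μ ≤ π} ≃
      {ε : DeltaSeq k S c // π.delta hH.closure_eq_top ≤ ε} := d.subtypeEquiv fun _ => Iff.rfl
  refine ⟨⟨r.symm.trans (e.toEquiv.trans d'), ?_⟩, ?_⟩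
  · intro ε ε'
    obtain ⟨μ, rfl⟩ := r.surjective ε
    obtain ⟨μ', rfl⟩ := r.surjective ε'
    simp only [Equiv.trans_apply, Equiv.symm_apply_apply]
    -- By definition ∂ reverses the order on both sides, hence the swapped arguments.
    exact e.map_rel_iff (a := μ') (b := μ)
  · intro ε i
    obtain ⟨μ, rfl⟩ := r.surjective ε
    have h1 : ((r.symm.trans (e.toEquiv.trans d')) (r μ)).entry i = (e μ).diff i := by
      simp only [Equiv.trans_apply, Equiv.symm_apply_apply]
      rfl
    have h2 : (r μ).1.entry i = μ.1.diff i := rfl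
    refine (congrArg Subtype.val h1).trans ?_
    have h3 := he μ i.1
    have h4 := he μ (i.1 + 1)
    rw [extend_coe, extend_coe, extend_coe] at h3
    rw [h2, Multichain.diff, Multichain.diff, Subgroup.coe_mul, Subgroup.coe_inv, h3, h4]
    group

end Isomorphisms

/-- The only geometric input to the isomorphisms: the moved space puts reflections below c into the
parabolic, and the exchange argument makes them reflections of it. -/
theorem isCompatible_parabolic {B : Type*} [Finite B] {M : CoxeterMatrix B} {W : Type*} [Group W]
    [Finite W] (cs : CoxeterSystem M W) {w : W} {I : Set B} {c : parabolic cs w I}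
    (hc : IsCoxeterElement (parabolicSimples cs w I) c) :
    IsCompatible (simples cs) (parabolicSimples cs w I) c := by
  obtain ⟨g, l, hl, hP, e, hlen⟩ := exists_eq_conj_wordProd cs hc
  refine ⟨cs.submonoid_closure_range_simple, closure_parabolicSimples cs w I,
    fun x hx => coe_mem_reflections cs hx, ?_, fun t ht htc => ?_⟩
  · rwa [e, absLength_conj_wordProd cs g hl]
  · have h : t ∈ parabolic cs w I := by
      rw [hP]
      rw [e] at htc
      exact mem_parabolic_of_absLE cs g hl htc
    exact ⟨h, mk_mem_reflections cs ht h⟩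

end KDivNC

theorem mainTheorem4 {B : Type*} [Finite B] {M : CoxeterMatrix B} {W : Type*} [Group W] [Finite W]
    (cs : CoxeterSystem M W)
    (c : W) (hc : KDivNC.IsCoxeterElement (KDivNC.simples cs) c)
    (k : ℕ∞) (hk : 1 ≤ k)
    (π : KDivNC.Multichain k (KDivNC.simples cs) c) :
    (∃! P : Subgroup W, KDivNC.IsCoxeterElementIn cs P (π.entry (KDivNC.Idx.first hk))) ∧
    ∀ (w : W) (I : Set B) (c' : KDivNC.parabolic cs w I),
      KDivNC.IsCoxeterElement (KDivNC.parabolicSimples cs w I) c' →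
      (c' : W) = π.entry (KDivNC.Idx.first hk) →
      (∃ e : {μ : KDivNC.Multichain k (KDivNC.simples cs) c // μ ≤ π} ≃o
            KDivNC.Multichain k (KDivNC.parabolicSimples cs w I) c',
          ∀ μ i, (((e μ).entry i : KDivNC.parabolic cs w I) : W) =
            μ.1.entry i * (π.entry i)⁻¹ * π.entry (KDivNC.Idx.first hk)) ∧
      (∃ e : {ε : KDivNC.DeltaSeq k (KDivNC.simples cs) c //
              π.delta cs.submonoid_closure_range_simple ≤ ε} ≃o
            KDivNC.DeltaSeq k (KDivNC.parabolicSimples cs w I) c',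
          ∀ ε i, (((e ε).entry i : KDivNC.parabolic cs w I) : W) =
            (π.entry (KDivNC.Idx.first hk))⁻¹ * π.entry i * ε.1.entry i *
              (KDivNC.extend c π.entry (i.1 + 1))⁻¹ * π.entry (KDivNC.Idx.first hk)) := by
  refine ⟨KDivNC.existsUnique_isCoxeterElementIn cs hc (π.mem_NC _).2, ?_⟩
  intro w I c' hc' h0
  have hH := KDivNC.isCompatible_parabolic cs hc'
  rw [← KDivNC.extend_zero (a := c) hk π.entry] at h0 ⊢
  constructor
  · obtain ⟨e, he⟩ := KDivNC.exists_multichain_orderIso hH h0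
    refine ⟨e, fun μ i => ?_⟩
    have h := he μ i.1
    rwa [KDivNC.extend_coe, KDivNC.extend_coe, KDivNC.extend_coe] at h
  · exact KDivNC.exists_deltaSeq_orderIso hH h0
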